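/- Let $\mathfrak g$ be the $N=1$ super Schrödinger algebra in $(1+1)$ dimensions: the complex Lie superalgebra with even basis $H,P,G,D,K,M$, odd basis $Q,S,X$ and nonvanishing brackets $[H,D]=2H$, $[H,K]=D$, $[D,K]=2K$, $[P,G]=M$, $[H,G]=P$, $[D,G]=G$, $[P,D]=P$, $[P,K]=G$; $\{Q,Q\}=-2H$, $\{S,S\}=-2K$, $\{X,X\}=-M$, $\{Q,X\}=-P$, $\{S,X\}=-G$, $\{Q,S\}=-D$; $[Q,D]=Q$, $[Q,K]=S$, $[D,S]=S$, $[H,S]=Q$, $[Q,G]=X$, $[P,S]=X$. Let $\mathfrak s^+$ be the subalgebra spanned by $G,K,S$, and $osp(1/2)$ the subalgebra spanned by $H,D,K,Q,S$. Modules are $\mathbb Z_2$-graded complex modules, irreducible means without proper nonzero graded submodules, and isomorphisms are taken up to an overall change of parity. For $d\in\mathbb R$ and $m\in\mathbb C$, a lowest weight module with parameters $(d,m)$ is a module generated by a nonzero homogeneous vector $v_0$ with $Qv_0=Pv_0=0$, $Dv_0=-dv_0$, $Mv_0=mv_0$. The Verma module $V^d$ is the one with $Xv_0=\chi v_0$,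 where for $m\neq0$ the symbol $\chi$ is an odd variable with $2\chi^2=m$ that anticommutes with $Q,S,X$, and $\chi=0$ for $m=0$; it is free over the coefficients ($\mathbb C\oplus\mathbb C\chi$, respectively $\mathbb C$) with basis $G^kK^\ell v_0,\ G^kK^\ell Sv_0$ $(k,\ell\ge0)$. Then the irreducible lowest weight modules over $\mathfrak g$ are classified as follows: for each $(d,m)$ there is up to isomorphism exactly one, modules with different $(d,m)$ are not isomorphic, and it is: 1. For $m\neq0$: - $V^d$, when $d\neq p-\frac12$ for all $p\in\mathbb Z_{\ge0}$; $\dim V^d=\infty$. - $V^d/I^d$, when $d=p-\frac12$ with $p\in\mathbb Z_{\ge0}$, where $I^d$ is the submodule generated by $v_s^p=(G^2-2mK)^p(G-2\chi S)v_0$, which equals $U(\mathfrak s^+)\,(\mathbb C\oplus\mathbb C\chi)\,v_s^p$; $\dim V^d/I^d=\infty$. 2. For $m=0$, let $I^1=U(\mathfrak s^+)\,Gv_0$, a submodule of $V^d$, and let $w_0$ be the class of $v_0$ in $V^d/I^1$: - $V^d/I^1$, when $d\notin\{0,1,2,\dots\}$; $\dim V^d/I^1=\infty$. - $(V^p/I^1)/\mathcal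 I^p$, when $d=p\in\{0,1,2,\dots\}$, where $\mathcal I^p=U(\mathfrak s^+)\,K^pSw_0$, a submodule of $V^p/I^1$; its dimension is $2p+1$. The representations for $m=0$ are also irreducible as representations of the subalgebra $osp(1/2)$. -/

import Mathlib

universe u v

namespace SSch

/-- The nine basis elements of the `N = 1` super Schrodinger algebra: `H, P, G, D, K, M` are even,
`Q, S, X` are odd. -/
inductive Gen
  | H | P | G | D | K | M | Q | S | X
  deriving DecidableEq

open Gen

instance : Fintype Gen := ⟨{H, P, G, D, K, M, Q, S, X}, fun x => by cases x <;> decide⟩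

/-- The `ℤ₂`-degree of a basis element. -/
def degree : Gen → ℕ
  | Q => 1
  | S => 1
  | X => 1
  | _ => 0

/-- The sign `(-1)^{|a||b|}`. -/
def sign (a b : Gen) : ℤ := (-1) ^ (degree a * degree b)

/-- The nonvanishing (anti)commutators, each listed in one order only. All of them are multiples of
a basis element: `(n, c)` stands for `n c`. -/
def table : Gen → Gen → ℤ × Gen
  | H, D => (2, H)
  | H, K => (1, D)
  | D, K => (2, K)
  | P, G => (1, M)
  | H, G => (1, P)
  | D, G => (1, G)
  | P, D => (1, P)
  | P, K => (1, G)
  | Q, Q => (-2, H)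
  | S, S => (-2, K)
  | X, X => (-1, M)
  | Q, X => (-1, P)
  | S, X => (-1, G)
  | Q, S => (-1, D)
  | Q, D => (1, Q)
  | Q, K => (1, S)
  | D, S => (1, S)
  | H, S => (1, Q)
  | Q, G => (1, X)
  | P, S => (1, X)
  | _, _ => (0, M)

/-- The super Lie bracket `[a, b} = n c` of two basis elements, as the pair `(n, c)`: the table
extended by `[b, a} = -(-1)^{|a||b|} [a, b}`. -/
def bracket (a b : Gen) : ℤ × Gen :=
  if (table a b).1 ≠ 0 then table a b else (-(sign a b * (table b a).1), (table b a).2)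

/-- The coefficient of the basis element `f` in `[a, b}`. -/
def bracketCoeff (a b f : Gen) : ℤ := if (bracket a b).2 = f then (bracket a b).1 else 0

theorem bracket_skew (a b f : Gen) :
    bracketCoeff a b f = -(sign a b * bracketCoeff b a f) := by
  revert a b f; decide +kernel

theorem bracket_degree (a b : Gen) (h : (bracket a b).1 ≠ 0) :
    degree (bracket a b).2 % 2 = (degree a + degree b) % 2 := by
  revert a b; decide +kernel

/-- The super Jacobi identity `[a, [b, c}} = [[a, b}, c} + (-1)^{|a||b|} [b, [a, c}}`. -/
theorem bracket_jacobi (a b c f : Gen) :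
    (bracket b c).1 * bracketCoeff a (bracket b c).2 f =
      (bracket a b).1 * bracketCoeff (bracket a b).2 c f +
        sign a b * ((bracket a c).1 * bracketCoeff b (bracket a c).2 f) := by
  revert a b c f; decide +kernel

/-- The basis `H, D, K, Q, S` of the subalgebra `osp(1/2)`. -/
def osp : Set Gen := {H, D, K, Q, S}

theorem osp_closed (a b : Gen) (ha : a ∈ osp) (hb : b ∈ osp) (h : (bracket a b).1 ≠ 0) :
    (bracket a b).2 ∈ osp := by
  have key : ∀ c : Gen, c ∈ osp ↔ c ∈ ({H, D, K, Q, S} : Finset Gen) := by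
    intro c; simp [osp]
  rw [key] at ha hb ⊢
  revert a b; decide +kernel

/-- The basis `G, K, S` of the positive part of the triangular decomposition. -/
def plus : Set Gen := {G, K, S}

/-- A module over the `N = 1` super Schrodinger algebra: a complex super vector space with an
action of the basis elements that respects degrees and the super Lie bracket. The `ℤ₂`-grading is
given by its parity involution `par`, which is `1` on the even part and `-1` on the odd part. -/
structure SRep where
  carrier : Type u
  [grp : AddCommGroup carrier]
  [mod : Module ℂ carrier]
  par : carrier →ₗ[ℂ] carrier
  par_par : ∀ x, par (par x) = x
  act : Gen → carrier →ₗ[ℂ] carrier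
  par_act : ∀ a x, par (act a x) = ((-1 : ℂ) ^ degree a) • act a (par x)
  act_bracket : ∀ a b x,
    act a (act b x) - (sign a b : ℂ) • act b (act a x) = ((bracket a b).1 : ℂ) • act (bracket a b).2 x

attribute [instance] SRep.grp SRep.mod

namespace SRep

instance : CoeSort SRep.{u} (Type u) := ⟨SRep.carrier⟩

/-- A subspace stable under the basis elements in `A`. -/
def Stable (V : SRep.{u}) (A : Set Gen) (N : Submodule ℂ V) : Prop :=
  ∀ a ∈ A, ∀ x ∈ N, V.act a x ∈ N

/-- A graded subspace: it contains the even and odd components of its elements. -/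
def Graded (V : SRep.{u}) (N : Submodule ℂ V) : Prop := ∀ x ∈ N, V.par x ∈ N

/-- Irreducibility under the subalgebra with basis `A`: the module is nonzero and has no graded
submodules but `0` and itself. -/
def IrreducibleUnder (V : SRep.{u}) (A : Set Gen) : Prop :=
  Nontrivial V ∧ ∀ N : Submodule ℂ V, V.Graded N → V.Stable A N → N = ⊥ ∨ N = ⊤

/-- Irreducibility under the whole superalgebra. -/
def Irreducible (V : SRep.{u}) : Prop := V.IrreducibleUnder Set.univ

/-- `U(A) W`: the smallest subspace that contains `W` and is stable under the basis elements
in `A`. -/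
def orbit (V : SRep.{u}) (A : Set Gen) (W : Set V) : Submodule ℂ V :=
  sInf {N | W ⊆ N ∧ V.Stable A N}

/-- Homogeneous vectors: purely even or purely odd. -/
def Homogeneous (V : SRep.{u}) (v : V) : Prop := V.par v = v ∨ V.par v = -v

/-- `v` is a lowest weight vector: `D v = -d v`, `M v = m v`, and `Q v = P v = 0`. -/
def IsLowestWeightVector (V : SRep.{u}) (d : ℝ) (m : ℂ) (v : V) : Prop :=
  v ≠ 0 ∧ V.Homogeneous v ∧ V.act Q v = 0 ∧ V.act P v = 0 ∧
    V.act D v = -(d : ℂ) • v ∧ V.act M v = m • v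

/-- A lowest weight module: it is generated by a lowest weight vector. -/
def IsLowestWeight (V : SRep.{u}) (d : ℝ) (m : ℂ) : Prop :=
  ∃ v : V, V.IsLowestWeightVector d m v ∧ V.orbit Set.univ {v} = ⊤


/-- A graded submodule. -/
structure Sub (V : SRep.{u}) where
  space : Submodule ℂ V
  graded : V.Graded space
  stable : V.Stable Set.univ space

/-- The graded submodule generated by `W`. -/
def gen (V : SRep.{u}) (W : Set V) : Sub V where
  space := sInf {N | W ⊆ N ∧ V.Graded N ∧ V.Stable Set.univ N}
  graded := fun x hx => by
    rw [Submodule.mem_sInf] at hx ⊢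
    exact fun N hN => hN.2.1 x (hx N hN)
  stable := fun a ha x hx => by
    rw [Submodule.mem_sInf] at hx ⊢
    exact fun N hN => hN.2.2 a ha x (hx N hN)

/-- The quotient module `V / N`. -/
def quot (V : SRep.{u}) (N : Sub V) : SRep.{u} where
  carrier := V.carrier ⧸ N.space
  par := N.space.mapQ N.space V.par N.graded
  par_par := by
    intro x
    obtain ⟨x, rfl⟩ := N.space.mkQ_surjective x
    exact congrArg N.space.mkQ (V.par_par x)
  act := fun a => N.space.mapQ N.space (V.act a) (N.stable a (Set.mem_univ a))
  par_act := by
    intro a x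
    obtain ⟨x, rfl⟩ := N.space.mkQ_surjective x
    exact congrArg N.space.mkQ (V.par_act a x)
  act_bracket := by
    intro a b x
    obtain ⟨x, rfl⟩ := N.space.mkQ_surjective x
    have h := congrArg N.space.mkQ (V.act_bracket a b x)
    simpa using h

/-- The canonical projection `V → V / N`. -/
def proj (V : SRep.{u}) (N : Sub V) : V →ₗ[ℂ] V.quot N := N.space.mkQ

end SRep

/-- Isomorphism of modules, up to an overall change of parity: a linear bijection that commutes
with the action and either preserves or exchanges the even and odd parts. -/
def Isomorphic (V : SRep.{u}) (W : SRep.{v}) : Prop :=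
  ∃ e : V ≃ₗ[ℂ] W, (∀ a x, e (V.act a x) = W.act a (e x)) ∧
    ((∀ x, e (V.par x) = W.par (e x)) ∨ (∀ x, e (V.par x) = -W.par (e x)))

noncomputable section Verma

/-!
The Verma module with coefficients in a super vector space `T` with parity involution `σ` and an
odd operator `χ` (multiplication by the odd variable `χ`) with `χ² = m / 2`. The vector
`single (false, k, l) t` is `t G^k K^l v₀`, and `single (true, k, l) t` is `t G^k K^l S v₀`.
Odd elements of the algebra anticommute with `χ`.
-/

variable {T : Type} [AddCommGroup T] [Module ℂ T]

/-- The vector `t G^k K^l v₀` (`s = false`) or `t G^k K^l S v₀` (`s = true`), linear in `t`. -/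
def bas (s : Bool) (k l : ℕ) : T →ₗ[ℂ] (Bool × ℕ × ℕ →₀ T) := Finsupp.lsingle (s, k, l)

/-- The action of the basis elements on `t G^k K^l v₀` and `t G^k K^l S v₀`. -/
def vermaActBasis (d : ℝ) (m : ℂ) (σ χ : T →ₗ[ℂ] T) :
    Gen → Bool → ℕ → ℕ → T →ₗ[ℂ] (Bool × ℕ × ℕ →₀ T)
  | K, s, k, l => bas s k (l + 1)
  | G, s, k, l => bas s (k + 1) l
  | D, false, k, l => ((k : ℂ) + 2 * l - d) • bas false k l
  | D, true, k, l => ((k : ℂ) + 2 * l + 1 - d) • bas true k l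
  | M, s, k, l => m • bas s k l
  | X, false, k, l => bas false k l ∘ₗ χ ∘ₗ σ
  | X, true, k, l => bas true k l ∘ₗ χ ∘ₗ σ - bas false (k + 1) l ∘ₗ σ
  | P, false, k, l => (l : ℂ) • bas false (k + 1) (l - 1) + (m * k) • bas false (k - 1) l
  | P, true, k, l => (l : ℂ) • bas true (k + 1) (l - 1) + bas false k l ∘ₗ χ
      + (m * k) • bas true (k - 1) l
  | S, false, k, l => bas true k l ∘ₗ σ
  | S, true, k, l => -(bas false k (l + 1) ∘ₗ σ)
  | Q, false, k, l => (k : ℂ) • (bas false (k - 1) l ∘ₗ χ ∘ₗ σ)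
      + (l : ℂ) • (bas true k (l - 1) ∘ₗ σ)
  | Q, true, k, l => (k : ℂ) • (bas true (k - 1) l ∘ₗ χ ∘ₗ σ)
      + ((d : ℂ) - l - k) • (bas false k l ∘ₗ σ)
  | H, false, k, l => ((l : ℂ) * (k + l - d - 1)) • bas false k (l - 1)
      + (1 / 2 * m * k * (k - 1)) • bas false (k - 2) l
  | H, true, k, l => ((l : ℂ) * (k + l - d)) • bas true k (l - 1)
      + (k : ℂ) • (bas false (k - 1) l ∘ₗ χ) + (1 / 2 * m * k * (k - 1)) • bas true (k - 2) l

/-- The action of the basis elements on the Verma module. -/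
def vermaAct (d : ℝ) (m : ℂ) (σ χ : T →ₗ[ℂ] T) (a : Gen) :
    (Bool × ℕ × ℕ →₀ T) →ₗ[ℂ] (Bool × ℕ × ℕ →₀ T) :=
  Finsupp.lsum ℂ fun b => vermaActBasis d m σ χ a b.1 b.2.1 b.2.2

/-- The parity involution of the Verma module; `v₀` is even. -/
def vermaPar (σ : T →ₗ[ℂ] T) : (Bool × ℕ × ℕ →₀ T) →ₗ[ℂ] (Bool × ℕ × ℕ →₀ T) :=
  Finsupp.lsum ℂ fun b => (if b.1 then (-1 : ℂ) else 1) • (bas b.1 b.2.1 b.2.2 ∘ₗ σ)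

theorem vermaAct_bas (d : ℝ) (m : ℂ) (σ χ : T →ₗ[ℂ] T) (a : Gen) (s : Bool) (k l : ℕ) (t : T) :
    vermaAct d m σ χ a (bas s k l t) = vermaActBasis d m σ χ a s k l t := by
  simp [vermaAct, bas]

theorem vermaPar_bas (σ : T →ₗ[ℂ] T) (s : Bool) (k l : ℕ) (t : T) :
    vermaPar σ (bas s k l t) = (if s then (-1 : ℂ) else 1) • bas s k l (σ t) := by
  cases s <;> simp [vermaPar, bas]

theorem bas_ext {W : Type*} [AddCommGroup W] [Module ℂ W] {f g : (Bool × ℕ × ℕ →₀ T) →ₗ[ℂ] W}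
    (h : ∀ s k l t, f (bas s k l t) = g (bas s k l t)) : f = g :=
  Finsupp.lhom_ext fun b t => h b.1 b.2.1 b.2.2 t

theorem verma_par_act (d : ℝ) (m : ℂ) (σ χ : T →ₗ[ℂ] T) (hσ : ∀ t, σ (σ t) = t)
    (hσχ : ∀ t, σ (χ t) = -χ (σ t)) (a : Gen) (x : Bool × ℕ × ℕ →₀ T) :
    vermaPar σ (vermaAct d m σ χ a x) =
      ((-1 : ℂ) ^ degree a) • vermaAct d m σ χ a (vermaPar σ x) := by
  have h : vermaPar σ ∘ₗ vermaAct d m σ χ a =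
      ((-1 : ℂ) ^ degree a) • (vermaAct d m σ χ a ∘ₗ vermaPar σ) := by
    refine bas_ext fun s k l t => ?_
    cases a <;> cases s <;>
      simp [vermaAct_bas, vermaPar_bas, vermaActBasis, degree, hσ, hσχ] <;> module
  exact LinearMap.congr_fun h x

/-- An auxiliary numbering of the basis. -/
def num : Gen → ℕ
  | H => 0
  | P => 1
  | G => 2
  | D => 3
  | K => 4
  | M => 5
  | Q => 6
  | S => 7
  | X => 8

set_option linter.unusedSimpArgs false in
set_option maxHeartbeats 4000000 in
theorem verma_bracket_aux (d : ℝ) (m : ℂ) (σ χ : T →ₗ[ℂ] T) (hσ : ∀ t, σ (σ t) = t)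
    (hσχ : ∀ t, σ (χ t) = -χ (σ t)) (hχ : ∀ t, χ (χ t) = (m / 2) • t) (a b : Gen)
    (hab : num a ≤ num b) (s : Bool) (k l : ℕ) (t : T) :
    vermaAct d m σ χ a (vermaAct d m σ χ b (bas s k l t)) -
        (sign a b : ℂ) • vermaAct d m σ χ b (vermaAct d m σ χ a (bas s k l t)) =
      ((bracket a b).1 : ℂ) • vermaAct d m σ χ (bracket a b).2 (bas s k l t) := by
  cases a <;> cases b <;> simp only [num, Nat.reduceLeDiff] at hab
  all_goals clear hab
  all_goals simp only [bracket, table, sign, degree, mul_zero, mul_one, pow_zero, pow_one,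
    ne_eq, not_true_eq_false, not_false_eq_true, reduceIte, Int.reduceNeg, Int.reduceEq,
    Int.cast_neg, Int.cast_zero, Int.cast_one, zero_smul, neg_zero, one_smul,
    neg_smul, sub_neg_eq_add, Int.cast_ofNat, OfNat.ofNat_ne_zero, one_ne_zero]
  all_goals cases s
  all_goals simp only [vermaAct_bas, vermaActBasis, LinearMap.sub_apply, LinearMap.smul_apply,
    LinearMap.comp_apply, LinearMap.neg_apply, LinearMap.add_apply, map_add, map_smul, map_neg,
    map_sub, hσ, hσχ, hχ]
  all_goals try module
  all_goals rcases k with _ | _ | _ | k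
  all_goals simp only [Nat.add_sub_cancel, Nat.zero_sub, Nat.sub_self, Nat.cast_zero,
    Nat.cast_add, Nat.cast_one, zero_smul, zero_mul, mul_zero, add_zero, zero_add, smul_zero,
    Nat.reduceAdd, Nat.reduceSub, Nat.add_one_sub_one, Nat.reduceSubDiff, smul_neg, smul_add]
  all_goals try module
  all_goals rcases l with _ | _ | l
  all_goals simp only [Nat.add_sub_cancel, Nat.zero_sub, Nat.sub_self, Nat.cast_zero,
    Nat.cast_add, Nat.cast_one, zero_smul, zero_mul, mul_zero, add_zero, zero_add, smul_zero,
    Nat.reduceAdd, Nat.reduceSub, Nat.add_one_sub_one, Nat.reduceSubDiff, smul_neg, smul_add]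
  all_goals module

theorem verma_bracket (d : ℝ) (m : ℂ) (σ χ : T →ₗ[ℂ] T) (hσ : ∀ t, σ (σ t) = t)
    (hσχ : ∀ t, σ (χ t) = -χ (σ t)) (hχ : ∀ t, χ (χ t) = (m / 2) • t) (a b : Gen)
    (x : Bool × ℕ × ℕ →₀ T) :
    vermaAct d m σ χ a (vermaAct d m σ χ b x) -
        (sign a b : ℂ) • vermaAct d m σ χ b (vermaAct d m σ χ a x) =
      ((bracket a b).1 : ℂ) • vermaAct d m σ χ (bracket a b).2 x := by
  have h : vermaAct d m σ χ a ∘ₗ vermaAct d m σ χ b -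
        (sign a b : ℂ) • (vermaAct d m σ χ b ∘ₗ vermaAct d m σ χ a) =
      ((bracket a b).1 : ℂ) • vermaAct d m σ χ (bracket a b).2 := by
    refine bas_ext fun s k l t => ?_
    rcases le_total (num a) (num b) with hab | hab
    · simpa using verma_bracket_aux d m σ χ hσ hσχ hχ a b hab s k l t
    · have h1 := verma_bracket_aux d m σ χ hσ hσχ hχ b a hab s k l t
      have h2 : sign a b = sign b a ∧ sign b a * sign b a = 1 ∧
          (bracket a b).1 = -(sign b a * (bracket b a).1) ∧
          ((bracket a b).1 = 0 ∨ (bracket a b).2 = (bracket b a).2) := by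
        clear h1 hab
        revert a b; decide +kernel
      obtain ⟨h2, h3, h4, h5⟩ := h2
      have h3' : (sign b a : ℂ) * (sign b a : ℂ) = 1 := by exact_mod_cast h3
      have h6 : ((bracket a b).1 : ℂ) • vermaAct d m σ χ (bracket a b).2 (bas s k l t) =
          -((sign b a : ℂ) • ((bracket b a).1 : ℂ) •
            vermaAct d m σ χ (bracket b a).2 (bas s k l t)) := by
        rcases h5 with h5 | h5
        · have : sign b a * (bracket b a).1 = 0 := by omega
          have h7 : (sign b a : ℂ) * ((bracket b a).1 : ℂ) = 0 := by exact_mod_cast this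
          rw [h5, smul_smul, h7]; simp
        · rw [h5, h4]; push_cast; module
      simp only [LinearMap.sub_apply, LinearMap.smul_apply, LinearMap.comp_apply]
      rw [h6, ← h1, h2, smul_sub, smul_smul, h3']
      module
  simpa using LinearMap.congr_fun h x

/-- The Verma module with lowest weight `-d`, mass `m` and coefficients in `T`. -/
def vermaOn (d : ℝ) (m : ℂ) (σ χ : T →ₗ[ℂ] T) (hσ : ∀ t, σ (σ t) = t)
    (hσχ : ∀ t, σ (χ t) = -χ (σ t)) (hχ : ∀ t, χ (χ t) = (m / 2) • t) : SRep.{0} where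
  carrier := Bool × ℕ × ℕ →₀ T
  par := vermaPar σ
  par_par := by
    have h : vermaPar σ ∘ₗ vermaPar σ = LinearMap.id := by
      refine bas_ext fun s k l t => ?_
      cases s <;> simp [vermaPar_bas, hσ]
    exact fun x => LinearMap.congr_fun h x
  act := vermaAct d m σ χ
  par_act := verma_par_act d m σ χ hσ hσχ
  act_bracket := verma_bracket d m σ χ hσ hσχ hχ

/-- The coefficients `ℂ ⊕ ℂ χ` with `χ` odd and `χ² = m / 2`: the pair `(a, b)` is `a + b χ`.
This is their parity involution. -/
def coefPar : ℂ × ℂ →ₗ[ℂ] ℂ × ℂ := LinearMap.prodMap LinearMap.id (-LinearMap.id)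

/-- Multiplication by `χ` on `ℂ ⊕ ℂ χ`: `χ (a + b χ) = (m / 2) b + a χ`. -/
def coefChi (m : ℂ) : ℂ × ℂ →ₗ[ℂ] ℂ × ℂ :=
  LinearMap.prod ((m / 2) • LinearMap.snd ℂ ℂ ℂ) (LinearMap.fst ℂ ℂ ℂ)

/-- The Verma module `V^d` for mass `m ≠ 0`, where `X v₀ = χ v₀` with an odd variable `χ`
such that `m = 2 χ²`. -/
def verma (d : ℝ) (m : ℂ) : SRep.{0} :=
  vermaOn d m coefPar (coefChi m) (fun t => by simp [coefPar])
    (fun t => by simp [coefPar, coefChi]) (fun t => by ext <;> simp [coefChi])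

/-- The lowest weight vector `v₀` of `V^d`. -/
def vermaVec (d : ℝ) (m : ℂ) : verma d m := (bas false 0 0 (1, 0) : Bool × ℕ × ℕ →₀ ℂ × ℂ)

/-- Left multiplication by the odd variable `χ` on `V^d`. -/
def chiMul (d : ℝ) (m : ℂ) : verma d m →ₗ[ℂ] verma d m :=
  (Finsupp.mapRange.linearMap (coefChi m) : (Bool × ℕ × ℕ →₀ ℂ × ℂ) →ₗ[ℂ] _)

/-- The singular vector `(G² - 2 m K)^p (G - 2 χ S) v₀` of `V^d`, `d = p - 1/2`. -/
def singVec (p : ℕ) (m : ℂ) : verma (p - 1 / 2) m :=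
  let V := verma (p - 1 / 2) m
  let v₀ : V := vermaVec (p - 1 / 2) m
  ((V.act G ^ 2 - (2 * m) • V.act K) ^ p)
    (V.act G v₀ - (2 : ℂ) • chiMul (p - 1 / 2) m (V.act S v₀))

/-- The submodule `I^d` of `V^d`, `d = p - 1/2`, generated by the singular vector. -/
def singSub (p : ℕ) (m : ℂ) : SRep.Sub (verma (p - 1 / 2) m) :=
  (verma (p - 1 / 2) m).gen {singVec p m}

/-- The Verma module `V^d` for mass `m = 0`, where `χ = 0`, so that `X v₀ = 0`. -/
def verma₀ (d : ℝ) : SRep.{0} :=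
  vermaOn d 0 (LinearMap.id : ℂ →ₗ[ℂ] ℂ) 0 (fun t => by simp) (fun t => by simp)
    (fun t => by simp)

/-- The lowest weight vector `v₀` of the massless `V^d`. -/
def verma₀Vec (d : ℝ) : verma₀ d := (bas false 0 0 1 : Bool × ℕ × ℕ →₀ ℂ)

/-- The submodule `I^1` of the massless `V^d`, generated by the singular vector `G v₀`. -/
def singSub₀ (d : ℝ) : SRep.Sub (verma₀ d) := (verma₀ d).gen {(verma₀ d).act G (verma₀Vec d)}

/-- The factor module `V^d / I^1` for `m = 0`. -/
def factor₀ (d : ℝ) : SRep.{0} := (verma₀ d).quot (singSub₀ d)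

/-- The vector `K^p S w₀` of `V^p / I^1`, where `w₀` is the class of `v₀`. -/
def singVec₁ (p : ℕ) : factor₀ p :=
  ((factor₀ p).act K ^ p) ((factor₀ p).act S ((verma₀ p).proj (singSub₀ p) (verma₀Vec p)))

/-- The submodule of `V^p / I^1` generated by `K^p S w₀`. -/
def singSub₁ (p : ℕ) : SRep.Sub (factor₀ p) := (factor₀ p).gen {singVec₁ p}

end Verma

/-- `L` is, up to isomorphism, the one irreducible lowest weight module with lowest weight `-d`
and mass `m`. -/
def IsTheIrreducible (L : SRep.{v}) (d : ℝ) (m : ℂ) : Prop :=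
  L.Irreducible ∧ L.IsLowestWeight d m ∧
    ∀ V : SRep.{u}, V.Irreducible → V.IsLowestWeight d m → Isomorphic V L

end SSch

open SSch

namespace SSch

open Gen

/-! ### Submodules generated by vectors, and quotients -/

namespace SRep

/-! Uniqueness is the usual highest weight argument, turned upside down and made graded. Every
lowest weight module is an image of the universal module `verma d m` under `vermaLift`, with `χ v₀`
going to `X w`. This works for `m = 0` too, where `χ² = 0` and `X w` is still allowed to be nonzero.
`D` separates levels and the parity separates `v₀` from `χ v₀`, so a proper graded submodule has no
component along `v₀` (`coef_eq_zero_of_proper`). Hence the kernel belonging to an irreducible module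
is the largest proper graded submodule (`le_vermaLift_ker`), the same for all irreducible modules
with given parameters. Conversely the weights bounded below by `-d` recover `d`, and the scalar `M`
recovers `m`.

Irreducibility of the listed modules is proved by descending with `Q` from a weight vector to `v₀`.

For `m = 0`, dividing by `I^1` removes all vectors containing `G`. The rest is a single chain `K^l
w₀`, `K^l S w₀`, one vector per level, along which `Q` has coefficients `l` and `d - l`. The descent
is blocked only when `d = l`, and what lies above the block is the submodule generated by `K^p S
w₀`. The descent and the rebuilding use only `osp(1/2)`.

For `m ≠ 0`, `P` and `G` satisfy the Heisenberg relation and `P` is locally nilpotent, so a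
submodule is controlled by its vectors killed by `P` (`le_of_inf_ker_P_le`). These again form one
chain over `ℂ ⊕ ℂχ`: `(G² - 2mK)^l v₀` and `(G² - 2mK)^l (G - 2χS) v₀` (`exists_eq_vacVec`). Along
it `Q` has coefficients `2(l + 1)` and `1 + 2d - 2l`, up to the invertible `χ`, so the only block is
at `d = l - 1/2`. What lies above it is contained in `I^d`, which therefore contains every proper
graded submodule (`proper_le`). -/

theorem act_act (V : SRep.{u}) (a b : Gen) (x : V) :
    V.act a (V.act b x) = (sign a b : ℂ) • V.act b (V.act a x) +
      ((bracket a b).1 : ℂ) • V.act (bracket a b).2 x := by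
  rw [← V.act_bracket a b x]; abel

theorem subset_orbit (V : SRep.{u}) (A : Set Gen) (W : Set V) : W ⊆ V.orbit A W := by
  intro x hx
  simp only [orbit, SetLike.mem_coe, Submodule.mem_sInf]
  exact fun N hN => hN.1 hx

theorem orbit_stable (V : SRep.{u}) (A : Set Gen) (W : Set V) : V.Stable A (V.orbit A W) := by
  intro a ha x hx
  simp only [orbit, Submodule.mem_sInf] at hx ⊢
  exact fun N hN => hN.2 a ha x (hx N hN)

theorem orbit_le (V : SRep.{u}) {A : Set Gen} {W : Set V} {N : Submodule ℂ V}
    (h : W ⊆ N) (hN : V.Stable A N) : V.orbit A W ≤ N :=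
  sInf_le ⟨h, hN⟩

theorem Stable.mono {V : SRep.{u}} {A B : Set Gen} {N : Submodule ℂ V} (h : V.Stable B N)
    (hAB : A ⊆ B) : V.Stable A N :=
  fun a ha => h a (hAB ha)

theorem IrreducibleUnder.irreducible {V : SRep.{u}} {A : Set Gen} (h : V.IrreducibleUnder A) :
    V.Irreducible :=
  ⟨h.1, fun N hg hs => h.2 N hg (hs.mono (Set.subset_univ A))⟩

/-- `U(s⁺) W` is a submodule as soon as the remaining basis elements map `W` into it. -/
theorem orbit_plus_stable (V : SRep.{u}) (W : Set V)
    (h : ∀ a, a ∉ plus → ∀ w ∈ W, V.act a w ∈ V.orbit plus W) :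
    V.Stable Set.univ (V.orbit plus W) := by
  -- All basis elements `a` are treated at once: in `a g x = ± g a x + [a, g} x` the bracket is a
  -- multiple of another basis element, already known to map `x` into the orbit.
  have key : V.orbit plus W ≤ ⨅ a, (V.orbit plus W ⊓ (V.orbit plus W).comap (V.act a)) := by
    refine V.orbit_le ?_ ?_
    · intro w hw
      simp only [Submodule.coe_iInf, Set.mem_iInter, SetLike.mem_coe, Submodule.mem_inf,
        Submodule.mem_comap]
      intro a
      refine ⟨V.subset_orbit _ _ hw, ?_⟩
      by_cases ha : a ∈ plus
      · exact V.orbit_stable _ _ a ha _ (V.subset_orbit _ _ hw)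
      · exact h a ha w hw
    · intro g hg x hx
      simp only [Submodule.mem_iInf, Submodule.mem_inf, Submodule.mem_comap] at hx ⊢
      intro a
      refine ⟨(hx g).2, ?_⟩
      rw [V.act_act a g x]
      exact add_mem (Submodule.smul_mem _ _ (V.orbit_stable _ _ g hg _ (hx a).2))
        (Submodule.smul_mem _ _ (hx _).2)
  intro a _ x hx
  have := key hx
  simp only [Submodule.mem_iInf, Submodule.mem_inf, Submodule.mem_comap] at this
  exact (this a).2

theorem orbit_graded (V : SRep.{u}) (A : Set Gen) (W : Set V)
    (h : ∀ w ∈ W, V.par w ∈ V.orbit A W) : V.Graded (V.orbit A W) := by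
  have key : V.orbit A W ≤ (V.orbit A W).comap V.par ⊓ V.orbit A W := by
    refine V.orbit_le (fun w hw => ⟨h w hw, V.subset_orbit _ _ hw⟩) ?_
    rintro a ha x ⟨hx, hx'⟩
    refine ⟨?_, V.orbit_stable _ _ a ha x hx'⟩
    rw [SetLike.mem_coe, Submodule.mem_comap, V.par_act]
    exact Submodule.smul_mem _ _ (V.orbit_stable _ _ a ha _ hx)
  exact fun x hx => (key hx).1

theorem gen_le (V : SRep.{u}) {W : Set V} {N : Submodule ℂ V} (h : W ⊆ N) (hg : V.Graded N)
    (hs : V.Stable Set.univ N) : (V.gen W).space ≤ N :=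
  sInf_le ⟨h, hg, hs⟩

theorem subset_gen (V : SRep.{u}) (W : Set V) : W ⊆ (V.gen W).space := by
  intro x hx
  simp only [gen, SetLike.mem_coe, Submodule.mem_sInf]
  exact fun N hN => hN.1 hx

/-- The larger set `W'` allows for the massive case, where one singular vector generates the
submodule but `U(s⁺)` needs its multiple by `χ` as well. -/
theorem gen_eq_orbit_plus (V : SRep.{u}) {W W' : Set V} (hW : W ⊆ W')
    (hW' : W' ⊆ (V.gen W).space) (hp : ∀ w ∈ W', V.par w ∈ V.orbit plus W')
    (h : ∀ a, a ∉ plus → ∀ w ∈ W', V.act a w ∈ V.orbit plus W') :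
    (V.gen W).space = V.orbit plus W' :=
  le_antisymm
    (V.gen_le (hW.trans (V.subset_orbit _ _)) (V.orbit_graded _ _ hp) (V.orbit_plus_stable _ h))
    (V.orbit_le hW' ((V.gen W).stable.mono (Set.subset_univ _)))

/-- Irreducibility of a quotient, in terms of submodules upstairs. -/
theorem irreducibleUnder_quot (V : SRep.{u}) (I : Sub V) (A : Set Gen) (hI : I.space ≠ ⊤)
    (h : ∀ N : Submodule ℂ V, V.Graded N → V.Stable A N → I.space ≤ N → N ≤ I.space ∨ N = ⊤) :
    (V.quot I).IrreducibleUnder A := by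
  refine ⟨Submodule.Quotient.nontrivial_iff.mpr hI, fun N hg hs => ?_⟩
  have hle : I.space ≤ N.comap (V.proj I) := by
    intro x hx
    have : V.proj I x = 0 := (Submodule.Quotient.mk_eq_zero _).mpr hx
    rw [Submodule.mem_comap, this]
    exact N.zero_mem
  rcases h (N.comap (V.proj I)) (fun x hx => hg _ hx) (fun a ha x hx => hs a ha _ hx) hle
    with h | h
  · left
    rw [eq_bot_iff]
    intro y hy
    obtain ⟨x, rfl⟩ := I.space.mkQ_surjective y
    exact (Submodule.Quotient.mk_eq_zero _).mpr (h hy)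
  · right
    rw [eq_top_iff]
    intro y _
    obtain ⟨x, rfl⟩ := I.space.mkQ_surjective y
    have : x ∈ N.comap (V.proj I) := h ▸ Submodule.mem_top
    exact this

theorem proj_eq_zero (V : SRep.{u}) (I : Sub V) (x : V) : V.proj I x = 0 ↔ x ∈ I.space :=
  Submodule.Quotient.mk_eq_zero _

theorem orbit_proj_eq_top (V : SRep.{u}) (I : Sub V) (v : V) (h : V.orbit Set.univ {v} = ⊤) :
    (V.quot I).orbit Set.univ {V.proj I v} = ⊤ := by
  have hle : V.orbit Set.univ {v} ≤
      ((V.quot I).orbit Set.univ {V.proj I v}).comap (V.proj I) := by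
    refine V.orbit_le ?_ fun a ha x hx => (V.quot I).orbit_stable _ _ a ha _ hx
    rintro _ rfl
    exact (V.quot I).subset_orbit _ _ rfl
  rw [eq_top_iff]
  intro y _
  obtain ⟨x, rfl⟩ := I.space.mkQ_surjective y
  exact hle (h ▸ Submodule.mem_top)

theorem isLowestWeightVector_proj (V : SRep.{u}) (I : Sub V) {d : ℝ} {m : ℂ} {v : V}
    (h : V.IsLowestWeightVector d m v) (hv : v ∉ I.space) :
    (V.quot I).IsLowestWeightVector d m (V.proj I v) := by
  obtain ⟨-, hh, hQ, hP, hD, hM⟩ := h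
  refine ⟨fun h0 => hv ((V.proj_eq_zero I v).mp h0), ?_, ?_, ?_, ?_, ?_⟩
  · rcases hh with hh | hh
    · exact Or.inl (congrArg (V.proj I) hh)
    · exact Or.inr ((congrArg (V.proj I) hh).trans (map_neg _ _))
  · exact (congrArg (V.proj I) hQ).trans (map_zero _)
  · exact (congrArg (V.proj I) hP).trans (map_zero _)
  · exact (congrArg (V.proj I) hD).trans (map_smul _ _ _)
  · exact (congrArg (V.proj I) hM).trans (map_smul _ _ _)

/-! ### The commutation relations in a module -/

theorem G_K (V : SRep.{u}) (x : V) : V.act G (V.act K x) = V.act K (V.act G x) := by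
  simpa [sign, degree, bracket, table, sub_eq_zero] using V.act_bracket G K x

theorem S_G (V : SRep.{u}) (x : V) : V.act S (V.act G x) = V.act G (V.act S x) := by
  simpa [sign, degree, bracket, table, sub_eq_zero] using V.act_bracket S G x

theorem S_K (V : SRep.{u}) (x : V) : V.act S (V.act K x) = V.act K (V.act S x) := by
  simpa [sign, degree, bracket, table, sub_eq_zero] using V.act_bracket S K x

theorem X_G (V : SRep.{u}) (x : V) : V.act X (V.act G x) = V.act G (V.act X x) := by
  simpa [sign, degree, bracket, table, sub_eq_zero] using V.act_bracket X G x

theorem X_K (V : SRep.{u}) (x : V) : V.act X (V.act K x) = V.act K (V.act X x) := by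
  simpa [sign, degree, bracket, table, sub_eq_zero] using V.act_bracket X K x

theorem M_comm (V : SRep.{u}) (a : Gen) (x : V) : V.act M (V.act a x) = V.act a (V.act M x) := by
  cases a <;>
    first
    | rfl
    | simpa [sign, degree, bracket, table, sub_eq_zero] using V.act_bracket M _ x

theorem P_G (V : SRep.{u}) (x : V) :
    V.act P (V.act G x) = V.act G (V.act P x) + V.act M x := by
  simpa [sign, degree, bracket, table, sub_eq_iff_eq_add'] using V.act_bracket P G x

theorem P_K (V : SRep.{u}) (x : V) :
    V.act P (V.act K x) = V.act K (V.act P x) + V.act G x := by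
  simpa [sign, degree, bracket, table, sub_eq_iff_eq_add'] using V.act_bracket P K x

theorem Q_G (V : SRep.{u}) (x : V) :
    V.act Q (V.act G x) = V.act G (V.act Q x) + V.act X x := by
  simpa [sign, degree, bracket, table, sub_eq_iff_eq_add'] using V.act_bracket Q G x

theorem Q_K (V : SRep.{u}) (x : V) :
    V.act Q (V.act K x) = V.act K (V.act Q x) + V.act S x := by
  simpa [sign, degree, bracket, table, sub_eq_iff_eq_add'] using V.act_bracket Q K x

theorem D_G (V : SRep.{u}) (x : V) :
    V.act D (V.act G x) = V.act G (V.act D x) + V.act G x := by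
  simpa [sign, degree, bracket, table, sub_eq_iff_eq_add'] using V.act_bracket D G x

theorem D_K (V : SRep.{u}) (x : V) :
    V.act D (V.act K x) = V.act K (V.act D x) + (2 : ℂ) • V.act K x := by
  simpa [sign, degree, bracket, table, sub_eq_iff_eq_add'] using V.act_bracket D K x

theorem D_X (V : SRep.{u}) (x : V) : V.act D (V.act X x) = V.act X (V.act D x) := by
  simpa [sign, degree, bracket, table, sub_eq_zero] using V.act_bracket D X x

theorem Q_X (V : SRep.{u}) (x : V) :
    V.act Q (V.act X x) = -V.act X (V.act Q x) - V.act P x := by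
  have h := V.act_bracket Q X x
  simp [sign, degree, bracket, table] at h
  rw [eq_sub_of_add_eq h]
  abel

theorem P_X (V : SRep.{u}) (x : V) : V.act P (V.act X x) = V.act X (V.act P x) := by
  simpa [sign, degree, bracket, table, sub_eq_zero] using V.act_bracket P X x

theorem P_S (V : SRep.{u}) (x : V) :
    V.act P (V.act S x) = V.act S (V.act P x) + V.act X x := by
  simpa [sign, degree, bracket, table, sub_eq_iff_eq_add'] using V.act_bracket P S x

theorem P_D (V : SRep.{u}) (x : V) :
    V.act P (V.act D x) = V.act D (V.act P x) + V.act P x := by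
  simpa [sign, degree, bracket, table, sub_eq_iff_eq_add'] using V.act_bracket P D x

theorem D_S (V : SRep.{u}) (x : V) :
    V.act D (V.act S x) = V.act S (V.act D x) + V.act S x := by
  simpa [sign, degree, bracket, table, sub_eq_iff_eq_add'] using V.act_bracket D S x

theorem Q_S (V : SRep.{u}) (x : V) :
    V.act Q (V.act S x) = -V.act S (V.act Q x) - V.act D x := by
  have h := V.act_bracket Q S x
  simp [sign, degree, bracket, table] at h
  rw [eq_sub_of_add_eq h]
  abel

theorem S_S (V : SRep.{u}) (x : V) : V.act S (V.act S x) = -V.act K x := by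
  have h := V.act_bracket S S x
  simp [sign, degree, bracket, table] at h
  have h2 : (2 : ℂ) • V.act S (V.act S x) = (2 : ℂ) • -V.act K x := by
    rw [two_smul, h]; module
  exact smul_right_injective _ two_ne_zero h2

theorem X_X (V : SRep.{u}) (x : V) : V.act X (V.act X x) = -((1 / 2 : ℂ) • V.act M x) := by
  have h := V.act_bracket X X x
  simp [sign, degree, bracket, table] at h
  have h2 : (2 : ℂ) • V.act X (V.act X x) = (2 : ℂ) • -((1 / 2 : ℂ) • V.act M x) := by
    rw [two_smul, h]; module
  exact smul_right_injective _ two_ne_zero h2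

/-- Because `H` is `-Q²`, a vector killed by `Q` is killed by `H`; this is why lowest weight vectors
carry no condition on `H`. -/
theorem Q_Q (V : SRep.{u}) (x : V) : V.act Q (V.act Q x) = -V.act H x := by
  have h := V.act_bracket Q Q x
  simp [sign, degree, bracket, table] at h
  have h2 : (2 : ℂ) • V.act Q (V.act Q x) = (2 : ℂ) • -V.act H x := by
    rw [two_smul, h]; module
  exact smul_right_injective _ two_ne_zero h2

/-- The central element acts on a lowest weight module by the mass. -/
theorem M_eq_smul (V : SRep.{u}) {m : ℂ} {v : V} (hM : V.act M v = m • v)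
    (h : V.orbit Set.univ {v} = ⊤) (x : V) : V.act M x = m • x := by
  have hle : V.orbit Set.univ {v} ≤ LinearMap.ker (V.act M - m • LinearMap.id) := by
    refine V.orbit_le ?_ ?_
    · rintro _ rfl
      simp [hM]
    · intro a _ y hy
      simp only [LinearMap.mem_ker, LinearMap.sub_apply, LinearMap.smul_apply, LinearMap.id_coe,
        id_eq, sub_eq_zero] at hy ⊢
      rw [V.M_comm, hy, map_smul]
  have : x ∈ LinearMap.ker (V.act M - m • LinearMap.id) := hle (h ▸ Submodule.mem_top)
  simpa [sub_eq_zero] using this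

/-- A module of nonzero mass has infinite dimension: `[P, G] = m` is not a commutator of
matrices. -/
theorem not_finiteDimensional_of_mass (V : SRep.{u}) [Nontrivial V] {m : ℂ} (hm : m ≠ 0)
    (hM : ∀ x, V.act M x = m • x) : ¬ FiniteDimensional ℂ V := by
  intro hfin
  have h1 : V.act P * V.act G - V.act G * V.act P = m • (1 : V →ₗ[ℂ] V) := by
    ext x
    simp [V.P_G, hM]
  have h2 := congrArg (LinearMap.trace ℂ V) h1
  rw [map_sub, LinearMap.trace_mul_comm, sub_self, map_smul, LinearMap.trace_one] at h2
  have h3 : Module.finrank ℂ V ≠ 0 := Module.finrank_pos.ne'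
  simp [hm, h3] at h2

end SRep

/-! ### Weight decomposition under `D` -/

/-- The components of an element of a stable subspace in eigenspaces with distinct eigenvalues
belong to the subspace. -/
theorem mem_of_sum_eigenvectors_mem {ι W : Type*} [DecidableEq ι] [AddCommGroup W] [Module ℂ W]
    (f : W →ₗ[ℂ] W) (N : Submodule ℂ W) (hN : ∀ x ∈ N, f x ∈ N) (c : ι → ℂ)
    (hc : Function.Injective c) (F : Finset ι) (y : ι → W) (hy : ∀ i, f (y i) = c i • y i)
    (h : ∑ i ∈ F, y i ∈ N) : ∀ i ∈ F, y i ∈ N := by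
  induction F using Finset.induction_on generalizing y with
  | empty => simp
  | insert j F hj ih =>
    -- Applying `f - c j` removes the `j`-th component and rescales the others by nonzero factors.
    have h1 : ∑ i ∈ F, (c i - c j) • y i ∈ N := by
      have : ∑ i ∈ F, (c i - c j) • y i =
          f (∑ i ∈ insert j F, y i) - c j • ∑ i ∈ insert j F, y i := by
        rw [map_sum, Finset.smul_sum, ← Finset.sum_sub_distrib, Finset.sum_insert hj]
        simp [hy, sub_smul]
      rw [this]
      exact sub_mem (hN _ h) (N.smul_mem _ h)
    have h2 := ih (fun i => (c i - c j) • y i)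
      (fun i => by rw [map_smul, hy, smul_comm]) h1
    have h3 : ∀ i ∈ F, y i ∈ N := by
      intro i hi
      have hne : c i - c j ≠ 0 := sub_ne_zero.mpr fun e => hj (hc e ▸ hi)
      exact (N.smul_mem_iff hne).mp (h2 i hi)
    intro i hi
    rcases Finset.mem_insert.mp hi with rfl | hi
    · rw [Finset.sum_insert hj] at h
      exact (N.add_mem_iff_left (N.sum_mem h3)).mp h
    · exact h3 i hi

/-- The weight of a basis vector above the lowest weight. -/
def level (b : Bool × ℕ × ℕ) : ℕ := b.2.1 + 2 * b.2.2 + b.1.toNat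

theorem sum_filter_level {T : Type*} [AddCommGroup T] (x : Bool × ℕ × ℕ →₀ T) :
    ∑ n ∈ x.support.image level, x.filter (fun b => level b = n) = x := by
  ext1 b
  rw [Finsupp.finsetSum_apply]
  simp only [Finsupp.filter_apply, Finset.sum_ite_eq]
  split_ifs with h
  · rfl
  · by_contra h0
    exact h (Finset.mem_image_of_mem _ (Finsupp.mem_support_iff.mpr fun e => h0 e.symm))

section VermaBasics

variable {T : Type} [AddCommGroup T] [Module ℂ T]

theorem vermaAct_D_apply (d : ℝ) (m : ℂ) (σ χ : T →ₗ[ℂ] T) (x : Bool × ℕ × ℕ →₀ T)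
    (b : Bool × ℕ × ℕ) :
    vermaAct d m σ χ D x b = ((level b : ℂ) - d) • x b := by
  have h : Finsupp.lapply b ∘ₗ vermaAct d m σ χ D =
      ((level b : ℂ) - d) • Finsupp.lapply (R := ℂ) (M := T) b := by
    refine bas_ext fun s k l t => ?_
    by_cases hb : (s, k, l) = b
    · subst hb
      cases s <;> simp only [LinearMap.comp_apply, vermaAct_bas] <;>
        simp [vermaActBasis, bas, level]
    · cases s <;> simp only [LinearMap.comp_apply, vermaAct_bas] <;>
        simp [vermaActBasis, bas, hb]
  exact LinearMap.congr_fun h x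

theorem vermaAct_D_filter (d : ℝ) (m : ℂ) (σ χ : T →ₗ[ℂ] T) (x : Bool × ℕ × ℕ →₀ T) (n : ℕ) :
    vermaAct d m σ χ D (x.filter fun b => level b = n) =
      ((n : ℂ) - d) • x.filter fun b => level b = n := by
  ext1 b
  rw [vermaAct_D_apply, Finsupp.smul_apply, Finsupp.filter_apply]
  split_ifs with h
  · rw [h]
  · simp

theorem natCast_sub_injective (d : ℝ) : Function.Injective fun n : ℕ => (n : ℂ) - d :=
  fun _ _ h => Nat.cast_injective (sub_left_injective h)

/-- `D` is diagonal, and its eigenvalue `n - d` on level `n` determines `n`, so stability under `D`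
suffices to extract a level. -/
theorem filter_level_mem {d : ℝ} {m : ℂ} {σ χ : T →ₗ[ℂ] T}
    {N : Submodule ℂ (Bool × ℕ × ℕ →₀ T)} (hN : ∀ x ∈ N, vermaAct d m σ χ D x ∈ N)
    {x : Bool × ℕ × ℕ →₀ T} (hx : x ∈ N) (n : ℕ) : x.filter (fun b => level b = n) ∈ N := by
  by_cases hn : n ∈ x.support.image level
  · refine mem_of_sum_eigenvectors_mem (vermaAct d m σ χ D) N hN _ (natCast_sub_injective d)
      (x.support.image level) (fun n => x.filter fun b => level b = n)
      (fun n => vermaAct_D_filter d m σ χ x n) ?_ n hn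
    rwa [sum_filter_level]
  · have : x.filter (fun b => level b = n) = 0 := by
      rw [Finsupp.filter_eq_zero_iff]
      intro b hb
      by_contra h0
      exact hn (hb ▸ Finset.mem_image_of_mem _ (Finsupp.mem_support_iff.mpr h0))
    rw [this]
    exact N.zero_mem

theorem filter_level_zero (x : Bool × ℕ × ℕ →₀ T) :
    x.filter (fun b => level b = 0) = bas false 0 0 (x (false, 0, 0)) := by
  ext1 ⟨s, k, l⟩
  rw [Finsupp.filter_apply, bas, Finsupp.lsingle_apply, Finsupp.single_apply]
  have : level (s, k, l) = 0 ↔ (false, 0, 0) = (s, k, l) := by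
    cases s <;> simp [level, eq_comm]
  simp only [this]
  split_ifs with h
  · rw [h]
  · rfl

/-- The Verma module is generated by `T v₀` under `G, K, S`. -/
theorem verma_eq_top {d : ℝ} {m : ℂ} {σ χ : T →ₗ[ℂ] T} (hσ : ∀ t, σ (σ t) = t)
    {N : Submodule ℂ (Bool × ℕ × ℕ →₀ T)} (h0 : ∀ t, bas false 0 0 t ∈ N)
    (hN : ∀ a ∈ plus, ∀ x ∈ N, vermaAct d m σ χ a x ∈ N) : N = ⊤ := by
  have hK : ∀ s l t, bas s 0 l t ∈ N := by
    intro s l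
    induction l with
    | zero =>
      intro t
      cases s
      · exact h0 t
      · have := hN S (by simp [plus]) _ (h0 (σ t))
        simpa [vermaAct_bas, vermaActBasis, hσ] using this
    | succ l ih =>
      intro t
      simpa [vermaAct_bas, vermaActBasis] using hN K (by simp [plus]) _ (ih t)
  have hG : ∀ s k l t, bas s k l t ∈ N := by
    intro s k
    induction k with
    | zero => exact hK s
    | succ k ih =>
      intro l t
      simpa [vermaAct_bas, vermaActBasis] using hN G (by simp [plus]) _ (ih l t)
  rw [eq_top_iff]
  intro x _
  rw [← x.sum_single]
  exact N.sum_mem fun b _ => hG b.1 b.2.1 b.2.2 (x b)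

end VermaBasics

/-! ### The Verma module over `ℂ ⊕ ℂχ` -/

/-- The vector `t G^k K^l v₀` or `t G^k K^l S v₀` of `V^d`. -/
noncomputable def vermaBas (d : ℝ) (m : ℂ) (s : Bool) (k l : ℕ) : ℂ × ℂ →ₗ[ℂ] verma d m :=
  (bas s k l : ℂ × ℂ →ₗ[ℂ] (Bool × ℕ × ℕ →₀ ℂ × ℂ))

theorem verma_ext {d : ℝ} {m : ℂ} {W : Type*} [AddCommGroup W] [Module ℂ W]
    {f g : verma d m →ₗ[ℂ] W}
    (h : ∀ s k l t, f (vermaBas d m s k l t) = g (vermaBas d m s k l t)) : f = g :=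
  bas_ext (T := ℂ × ℂ) h

theorem coefPar_apply (t : ℂ × ℂ) : coefPar t = (t.1, -t.2) := rfl

theorem coefChi_apply (m : ℂ) (t : ℂ × ℂ) : coefChi m t = (m / 2 * t.2, t.1) := rfl

theorem coefPar_coefPar (t : ℂ × ℂ) : coefPar (coefPar t) = t := by simp [coefPar]

theorem coefPar_coefChi (m : ℂ) (t : ℂ × ℂ) :
    coefPar (coefChi m t) = -coefChi m (coefPar t) := by
  simp [coefPar, coefChi]

theorem coefChi_coefChi (m : ℂ) (t : ℂ × ℂ) : coefChi m (coefChi m t) = (m / 2) • t := by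
  ext <;> simp [coefChi]

/-- A subspace of the Verma module that contains `T v₀` and is stable under `G, K, S` is the whole
module. -/
theorem verma_eq_top_of_stable_plus {d : ℝ} {m : ℂ} {N : Submodule ℂ (verma d m)}
    (h0 : ∀ t, vermaBas d m false 0 0 t ∈ N) (hN : (verma d m).Stable plus N) : N = ⊤ :=
  verma_eq_top (T := ℂ × ℂ) (d := d) (m := m) (σ := coefPar) (χ := coefChi m)
    coefPar_coefPar h0 hN

section VermaBas

variable (d : ℝ) (m : ℂ) (s : Bool) (k l : ℕ) (t : ℂ × ℂ)

theorem par_vermaBas_false :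
    (verma d m).par (vermaBas d m false k l t) = vermaBas d m false k l (coefPar t) :=
  (vermaPar_bas _ _ _ _ _).trans (one_smul ℂ _)

theorem par_vermaBas_true :
    (verma d m).par (vermaBas d m true k l t) = -vermaBas d m true k l (coefPar t) :=
  (vermaPar_bas _ _ _ _ _).trans (by rw [if_pos rfl, neg_smul, one_smul]; rfl)

theorem G_vermaBas :
    (verma d m).act G (vermaBas d m s k l t) = vermaBas d m s (k + 1) l t :=
  (vermaAct_bas _ _ _ _ _ _ _ _ _).trans (by cases s <;> rfl)

theorem K_vermaBas :
    (verma d m).act K (vermaBas d m s k l t) = vermaBas d m s k (l + 1) t :=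
  (vermaAct_bas _ _ _ _ _ _ _ _ _).trans (by cases s <;> rfl)

theorem S_vermaBas_false :
    (verma d m).act S (vermaBas d m false k l t) = vermaBas d m true k l (coefPar t) :=
  vermaAct_bas _ _ _ _ _ _ _ _ _

theorem S_vermaBas_true :
    (verma d m).act S (vermaBas d m true k l t) = -vermaBas d m false k (l + 1) (coefPar t) :=
  vermaAct_bas _ _ _ _ _ _ _ _ _

theorem X_vermaBas_false :
    (verma d m).act X (vermaBas d m false k l t) =
      vermaBas d m false k l (coefChi m (coefPar t)) :=
  vermaAct_bas _ _ _ _ _ _ _ _ _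

theorem X_vermaBas_true :
    (verma d m).act X (vermaBas d m true k l t) =
      vermaBas d m true k l (coefChi m (coefPar t)) -
        vermaBas d m false (k + 1) l (coefPar t) :=
  vermaAct_bas _ _ _ _ _ _ _ _ _

theorem M_vermaBas :
    (verma d m).act M (vermaBas d m s k l t) = m • vermaBas d m s k l t :=
  (vermaAct_bas _ _ _ _ _ _ _ _ _).trans (by cases s <;> rfl)

theorem D_vermaBas_zero :
    (verma d m).act D (vermaBas d m false 0 0 t) = -(d : ℂ) • vermaBas d m false 0 0 t := by
  refine (vermaAct_bas _ _ _ _ _ _ _ _ _).trans ?_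
  simp [vermaActBasis]
  rfl

theorem P_vermaBas_zero : (verma d m).act P (vermaBas d m false 0 0 t) = 0 := by
  refine (vermaAct_bas _ _ _ _ _ _ _ _ _).trans ?_
  simp [vermaActBasis]
  rfl

theorem Q_vermaBas_zero : (verma d m).act Q (vermaBas d m false 0 0 t) = 0 := by
  refine (vermaAct_bas _ _ _ _ _ _ _ _ _).trans ?_
  simp [vermaActBasis]
  rfl

theorem H_vermaBas_zero : (verma d m).act H (vermaBas d m false 0 0 t) = 0 := by
  refine (vermaAct_bas _ _ _ _ _ _ _ _ _).trans ?_
  simp [vermaActBasis]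
  rfl

end VermaBas

/-- Since `X v₀ = χ v₀`, the vector `v₀` yields all its multiples by coefficients, even when `m = 0`
and `χ` is not invertible. -/
theorem verma_eq_top_of_mem {d : ℝ} {m : ℂ} {N : Submodule ℂ (verma d m)}
    (hs : (verma d m).Stable Set.univ N) (hv : vermaVec d m ∈ N) : N = ⊤ := by
  refine verma_eq_top_of_stable_plus (fun t => ?_) (hs.mono (Set.subset_univ _))
  have h1 := hs X trivial _ hv
  change (verma d m).act X (vermaBas d m false 0 0 (1, 0)) ∈ N at h1
  rw [X_vermaBas_false] at h1
  have h3 : vermaBas d m false 0 0 t =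
      t.1 • vermaVec d m + t.2 • vermaBas d m false 0 0 (coefChi m (coefPar (1, 0))) := by
    change _ = t.1 • vermaBas d m false 0 0 (1, 0) + _
    rw [← map_smul, ← map_smul, ← map_add]
    simp [coefChi, coefPar]
  rw [h3]
  exact N.add_mem (N.smul_mem _ hv) (N.smul_mem _ h1)

theorem vermaVec_orbit (d : ℝ) (m : ℂ) :
    (verma d m).orbit Set.univ {vermaVec d m} = ⊤ :=
  verma_eq_top_of_mem ((verma d m).orbit_stable _ _) ((verma d m).subset_orbit _ _ rfl)

theorem vermaVec_isLowestWeightVector (d : ℝ) (m : ℂ) :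
    (verma d m).IsLowestWeightVector d m (vermaVec d m) := by
  refine ⟨?_, Or.inl ?_, Q_vermaBas_zero _ _ _, P_vermaBas_zero _ _ _, D_vermaBas_zero _ _ _,
    M_vermaBas _ _ _ _ _ _⟩
  · intro h
    have h1 : (bas false 0 0 (1, 0) : Bool × ℕ × ℕ →₀ ℂ × ℂ) = 0 := h
    simp [bas] at h1
  · exact (par_vermaBas_false _ _ _ _ _).trans (by simp [coefPar]; rfl)

/-- A proper graded submodule of the Verma module has no component along `v₀`. -/
theorem coef_eq_zero_of_proper {d : ℝ} {m : ℂ} {N : Submodule ℂ (verma d m)}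
    (hg : (verma d m).Graded N) (hs : (verma d m).Stable Set.univ N) (hN : N ≠ ⊤)
    (x : Bool × ℕ × ℕ →₀ ℂ × ℂ) (hx : x ∈ N) : (x (false, 0, 0)).1 = 0 := by
  by_contra h
  have h1 := filter_level_mem (d := d) (m := m) (σ := coefPar) (χ := coefChi m) (N := N)
    (fun x hx => hs D trivial x hx) hx 0
  rw [filter_level_zero] at h1
  change vermaBas d m false 0 0 _ ∈ N at h1
  have h2 := hg _ h1
  rw [par_vermaBas_false] at h2
  -- Adding the parity image cancels the `χ v₀` part, which may well lie in a proper submodule when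
  -- `m = 0`, and doubles the `v₀` part.
  have h4 := N.add_mem h1 h2
  have h5 : vermaBas d m false 0 0 (x (false, 0, 0)) +
      vermaBas d m false 0 0 (coefPar (x (false, 0, 0))) =
      (2 * (x (false, 0, 0)).1) • vermaVec d m := by
    change _ = (2 * (x (false, 0, 0)).1) • vermaBas d m false 0 0 (1, 0)
    rw [← map_add, ← map_smul]
    congr 1
    ext
    · simp [coefPar, two_mul]
    · simp [coefPar]
  rw [h5] at h4
  exact hN (verma_eq_top_of_mem hs ((N.smul_mem_iff (mul_ne_zero two_ne_zero h)).mp h4))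

/-! ### The universal property of the Verma module -/

/-- The map `t ↦ t v₀` of the coefficients into a lowest weight module, where `χ v₀ = X v₀`. -/
noncomputable def coefMap (V : SRep.{u}) (w : V) : ℂ × ℂ →ₗ[ℂ] V :=
  LinearMap.coprod (LinearMap.toSpanSingleton ℂ V w) (LinearMap.toSpanSingleton ℂ V (V.act X w))

theorem coefMap_apply (V : SRep.{u}) (w : V) (t : ℂ × ℂ) :
    coefMap V w t = t.1 • w + t.2 • V.act X w := by
  simp [coefMap]

/-- The canonical map of the Verma module to a lowest weight module. -/
noncomputable def vermaLift (d : ℝ) (m : ℂ) (V : SRep.{u}) (w : V) : verma d m →ₗ[ℂ] V :=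
  (Finsupp.lsum ℂ fun b => (V.act G ^ b.2.1 * V.act K ^ b.2.2) ∘ₗ
    -- In `t S v₀` the coefficient stands to the left of the odd `S`; moving it next to `v₀` costs
    -- the parity sign.
    if b.1 then V.act S ∘ₗ coefMap V w ∘ₗ coefPar else coefMap V w :
    (Bool × ℕ × ℕ →₀ ℂ × ℂ) →ₗ[ℂ] V)

theorem vermaLift_bas_false (d : ℝ) (m : ℂ) (V : SRep.{u}) (w : V) (k l : ℕ) (t : ℂ × ℂ) :
    vermaLift d m V w (vermaBas d m false k l t) =
      (V.act G ^ k) ((V.act K ^ l) (coefMap V w t)) := by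
  refine (Finsupp.lsum_single _ _ _ _).trans ?_
  simp

theorem vermaLift_bas_true (d : ℝ) (m : ℂ) (V : SRep.{u}) (w : V) (k l : ℕ) (t : ℂ × ℂ) :
    vermaLift d m V w (vermaBas d m true k l t) =
      (V.act G ^ k) ((V.act K ^ l) (V.act S (coefMap V w (coefPar t)))) := by
  refine (Finsupp.lsum_single _ _ _ _).trans ?_
  simp

theorem SRep.K_G_pow (V : SRep.{u}) (k : ℕ) (x : V) :
    V.act K ((V.act G ^ k) x) = (V.act G ^ k) (V.act K x) :=
  LinearMap.congr_fun ((Commute.pow_right (show Commute (V.act K) (V.act G) from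
    LinearMap.ext fun x => (V.G_K x).symm) k).eq) x

theorem SRep.S_G_pow (V : SRep.{u}) (k : ℕ) (x : V) :
    V.act S ((V.act G ^ k) x) = (V.act G ^ k) (V.act S x) :=
  LinearMap.congr_fun ((Commute.pow_right (show Commute (V.act S) (V.act G) from
    LinearMap.ext fun x => V.S_G x) k).eq) x

theorem SRep.S_K_pow (V : SRep.{u}) (k : ℕ) (x : V) :
    V.act S ((V.act K ^ k) x) = (V.act K ^ k) (V.act S x) :=
  LinearMap.congr_fun ((Commute.pow_right (show Commute (V.act S) (V.act K) from
    LinearMap.ext fun x => V.S_K x) k).eq) x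

/-- The canonical map commutes with `G, K, S`. -/
theorem vermaLift_act_plus (d : ℝ) (m : ℂ) (V : SRep.{u}) (w : V) (a : Gen) (ha : a ∈ plus)
    (x : verma d m) :
    vermaLift d m V w ((verma d m).act a x) = V.act a (vermaLift d m V w x) := by
  have h : vermaLift d m V w ∘ₗ (verma d m).act a = V.act a ∘ₗ vermaLift d m V w := by
    refine verma_ext fun s k l t => ?_
    rw [LinearMap.comp_apply, LinearMap.comp_apply]
    simp only [plus, Set.mem_insert_iff, Set.mem_singleton_iff] at ha
    rcases ha with rfl | rfl | rfl <;> cases s <;>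
      simp only [G_vermaBas, K_vermaBas, S_vermaBas_false, S_vermaBas_true, vermaLift_bas_false,
        vermaLift_bas_true, map_neg, coefPar_coefPar]
    · rw [pow_succ']; rfl
    · rw [pow_succ']; rfl
    · rw [V.K_G_pow, pow_succ']; rfl
    · rw [V.K_G_pow, pow_succ']; rfl
    · rw [V.S_G_pow, V.S_K_pow]
    · rw [V.S_G_pow, V.S_K_pow, V.S_S, pow_succ]
      simp
  exact LinearMap.congr_fun h x

section Lift

variable {d : ℝ} {m : ℂ} {V : SRep.{u}} {w : V}

/-- The brackets force `X w` to behave like `χ v₀`: it is killed by `P`, `Q`, `H` and has the weight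
and mass of `w`. Moreover `X² w = -(m/2) w` agrees with `X χ v₀ = -χ² v₀`. -/
theorem vermaLift_act_bas (h : V.IsLowestWeightVector d m w) (a : Gen) (ha : a ∉ plus)
    (t : ℂ × ℂ) :
    vermaLift d m V w ((verma d m).act a (vermaBas d m false 0 0 t)) =
      V.act a (vermaLift d m V w (vermaBas d m false 0 0 t)) := by
  obtain ⟨-, -, hQ, hP, hD, hM⟩ := h
  have hH : V.act H w = 0 := by rw [← neg_eq_zero, ← V.Q_Q, hQ, map_zero]
  have hPX : V.act P (V.act X w) = 0 := by rw [V.P_X, hP, map_zero]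
  have hQX : V.act Q (V.act X w) = 0 := by rw [V.Q_X, hQ, hP]; simp
  have hHX : V.act H (V.act X w) = 0 := by rw [← neg_eq_zero, ← V.Q_Q, hQX, map_zero]
  have hDX : V.act D (V.act X w) = -(d : ℂ) • V.act X w := by rw [V.D_X, hD, map_smul]
  have hMX : V.act M (V.act X w) = m • V.act X w := by rw [V.M_comm, hM, map_smul]
  have hXX : V.act X (V.act X w) = -((1 / 2 : ℂ) • m • w) := by rw [V.X_X, hM]
  cases a
  case G => simp [plus] at ha
  case K => simp [plus] at ha
  case S => simp [plus] at ha
  all_goals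
    simp only [H_vermaBas_zero, P_vermaBas_zero, Q_vermaBas_zero, D_vermaBas_zero, M_vermaBas,
      X_vermaBas_false, map_zero, map_smul, vermaLift_bas_false, coefMap_apply, pow_zero,
      Module.End.one_apply, map_add, hQ, hP, hD, hM, hH, hPX, hQX, hHX, hDX, hMX, hXX,
      smul_zero, add_zero]
  · module
  · module
  · simp only [coefPar_apply, coefChi_apply]
    module

/-- The vectors on which the map commutes with every basis element simultaneously form a subspace
containing all `t v₀`. It is stable under `G, K, S` by `a g x = ± g a x + [a, g} x`, hence is
everything. -/
theorem vermaLift_act (h : V.IsLowestWeightVector d m w) (a : Gen) (x : verma d m) :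
    vermaLift d m V w ((verma d m).act a x) = V.act a (vermaLift d m V w x) := by
  let N : Submodule ℂ (verma d m) := ⨅ a, LinearMap.ker
    (vermaLift d m V w ∘ₗ (verma d m).act a - V.act a ∘ₗ vermaLift d m V w)
  have hN : ∀ x, x ∈ N ↔ ∀ a,
      vermaLift d m V w ((verma d m).act a x) = V.act a (vermaLift d m V w x) := by
    intro x
    simp [N, sub_eq_zero]
  have : N = ⊤ := by
    refine verma_eq_top_of_stable_plus (fun t => (hN _).mpr fun a => ?_)
      (fun g hg x hx => (hN _).mpr fun a => ?_)
    · by_cases ha : a ∈ plus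
      · exact vermaLift_act_plus d m V w a ha _
      · exact vermaLift_act_bas h a ha t
    · have hx := (hN x).mp hx
      rw [(verma d m).act_act a g x, map_add, map_smul, map_smul, vermaLift_act_plus d m V w g hg,
        vermaLift_act_plus d m V w g hg, hx, hx, V.act_act a g]
  exact (hN x).mp (this ▸ Submodule.mem_top) a

theorem vermaLift_par {ε : ℂ} (hε : V.par w = ε • w) (x : verma d m) :
    V.par (vermaLift d m V w x) = ε • vermaLift d m V w ((verma d m).par x) := by
  let N : Submodule ℂ (verma d m) := LinearMap.ker
    (V.par ∘ₗ vermaLift d m V w - ε • vermaLift d m V w ∘ₗ (verma d m).par)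
  have hN : ∀ x, x ∈ N ↔
      V.par (vermaLift d m V w x) = ε • vermaLift d m V w ((verma d m).par x) := by
    intro x
    simp [N, sub_eq_zero]
  have : N = ⊤ := by
    refine verma_eq_top_of_stable_plus (fun t => (hN _).mpr ?_)
      (fun g hg x hx => (hN _).mpr ?_)
    · rw [par_vermaBas_false]
      simp only [vermaLift_bas_false, pow_zero, Module.End.one_apply, coefMap_apply, map_add,
        map_smul, V.par_act, hε]
      simp only [degree, pow_one, coefPar, LinearMap.prodMap_apply, LinearMap.id_coe, id_eq,
        LinearMap.neg_apply]
      module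
    · rw [vermaLift_act_plus d m V w g hg, V.par_act, (hN x).mp hx, (verma d m).par_act,
        map_smul, map_smul, vermaLift_act_plus d m V w g hg, smul_comm]
  exact (hN x).mp (this ▸ Submodule.mem_top)

theorem vermaLift_vermaVec : vermaLift d m V w (vermaVec d m) = w := by
  refine (vermaLift_bas_false _ _ _ _ _ _ _).trans ?_
  simp [coefMap_apply]

theorem vermaLift_surjective (h : V.IsLowestWeightVector d m w)
    (hV : V.orbit Set.univ {w} = ⊤) : Function.Surjective (vermaLift d m V w) := by
  rw [← LinearMap.range_eq_top, eq_top_iff, ← hV]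
  refine V.orbit_le ?_ ?_
  · rintro _ rfl
    exact ⟨_, vermaLift_vermaVec⟩
  · rintro a _ _ ⟨x, rfl⟩
    exact ⟨_, vermaLift_act h a x⟩

theorem SRep.Homogeneous.exists_smul (h : V.Homogeneous w) :
    ∃ ε : ℂ, (ε = 1 ∨ ε = -1) ∧ V.par w = ε • w := by
  rcases h with h | h
  · exact ⟨1, Or.inl rfl, by simpa using h⟩
  · exact ⟨-1, Or.inr rfl, by simpa using h⟩

theorem vermaLift_ker_graded (h : V.Homogeneous w) :
    (verma d m).Graded (LinearMap.ker (vermaLift d m V w)) := by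
  obtain ⟨ε, hε, h⟩ := h.exists_smul
  intro x hx
  rw [LinearMap.mem_ker] at hx ⊢
  have := vermaLift_par (d := d) (m := m) h x
  rw [hx, map_zero, eq_comm, smul_eq_zero] at this
  refine this.resolve_left ?_
  rcases hε with rfl | rfl <;> simp

theorem vermaLift_ker_stable (h : V.IsLowestWeightVector d m w) :
    (verma d m).Stable Set.univ (LinearMap.ker (vermaLift d m V w)) := by
  intro a _ x hx
  rw [LinearMap.mem_ker] at hx ⊢
  rw [vermaLift_act h, hx, map_zero]

theorem vermaLift_ker_ne_top (h : V.IsLowestWeightVector d m w) :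
    LinearMap.ker (vermaLift d m V w) ≠ ⊤ := by
  intro e
  have : vermaVec d m ∈ LinearMap.ker (vermaLift d m V w) := e ▸ Submodule.mem_top
  rw [LinearMap.mem_ker, vermaLift_vermaVec] at this
  exact h.1 this

/-- The kernel of the canonical map to an irreducible lowest weight module contains every proper
graded submodule. -/
theorem le_vermaLift_ker (hV : V.Irreducible) (h : V.IsLowestWeightVector d m w)
    {N : Submodule ℂ (verma d m)} (hg : (verma d m).Graded N)
    (hs : (verma d m).Stable Set.univ N) (hN : N ≠ ⊤) :
    N ≤ LinearMap.ker (vermaLift d m V w) := by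
  obtain ⟨ε, hε, hpar⟩ := h.2.1.exists_smul
  have hmg : V.Graded (N.map (vermaLift d m V w)) := by
    rintro _ ⟨x, hx, rfl⟩
    rw [vermaLift_par hpar]
    exact Submodule.smul_mem _ _ ⟨_, hg x hx, rfl⟩
  have hms : V.Stable Set.univ (N.map (vermaLift d m V w)) := by
    rintro a _ _ ⟨x, hx, rfl⟩
    exact ⟨_, hs a trivial x hx, vermaLift_act h a x⟩
  rcases hV.2 _ hmg hms with h1 | h1
  · exact LinearMap.le_ker_iff_map.mpr h1
  · exfalso
    have : w ∈ N.map (vermaLift d m V w) := h1 ▸ Submodule.mem_top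
    obtain ⟨x, hx, hxw⟩ := this
    -- If `N` mapped onto `V`, then `v₀` would be the sum of an element of `N` and one of the
    -- kernel, both proper and so without `v₀` component.
    have hy : vermaVec d m - x ∈ LinearMap.ker (vermaLift d m V w) := by
      rw [LinearMap.mem_ker, map_sub, hxw, vermaLift_vermaVec, sub_self]
    have e1 := coef_eq_zero_of_proper hg hs hN x hx
    have e2 := coef_eq_zero_of_proper (vermaLift_ker_graded h.2.1) (vermaLift_ker_stable h)
      (vermaLift_ker_ne_top h) _ hy
    let z : Bool × ℕ × ℕ →₀ ℂ × ℂ := x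
    have e3 : ((bas false 0 0 ((1 : ℂ), (0 : ℂ)) - z) (false, 0, 0)).1 = 0 := e2
    change (z (false, 0, 0)).1 = 0 at e1
    rw [Finsupp.sub_apply, Prod.fst_sub, e1] at e3
    simp [bas] at e3

end Lift

/-! ### Uniqueness, and recovery of the parameters -/

/-- Irreducible lowest weight modules with the same parameters are isomorphic. -/
theorem isomorphic_of_irreducible {V : SRep.{u}} {W : SRep.{v}} {d : ℝ} {m : ℂ}
    (hV : V.Irreducible) (hW : W.Irreducible) (hVl : V.IsLowestWeight d m)
    (hWl : W.IsLowestWeight d m) : Isomorphic V W := by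
  obtain ⟨v, hv, hv'⟩ := hVl
  obtain ⟨w, hw, hw'⟩ := hWl
  -- Each kernel is proper and graded, and each contains every proper graded submodule.
  have hker : LinearMap.ker (vermaLift d m V v) = LinearMap.ker (vermaLift d m W w) :=
    le_antisymm
      (le_vermaLift_ker hW hw (vermaLift_ker_graded hv.2.1) (vermaLift_ker_stable hv)
        (vermaLift_ker_ne_top hv))
      (le_vermaLift_ker hV hv (vermaLift_ker_graded hw.2.1) (vermaLift_ker_stable hw)
        (vermaLift_ker_ne_top hw))
  have hsV := vermaLift_surjective hv hv'
  have hsW := vermaLift_surjective hw hw'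
  let e : V ≃ₗ[ℂ] W := ((vermaLift d m V v).quotKerEquivOfSurjective hsV).symm ≪≫ₗ
    Submodule.quotEquivOfEq _ _ hker ≪≫ₗ (vermaLift d m W w).quotKerEquivOfSurjective hsW
  have he : ∀ x, e (vermaLift d m V v x) = vermaLift d m W w x := by
    intro x
    have h1 : ((vermaLift d m V v).quotKerEquivOfSurjective hsV).symm (vermaLift d m V v x) =
        Submodule.Quotient.mk x := by
      rw [LinearEquiv.symm_apply_eq]
      rfl
    simp only [e, LinearEquiv.trans_apply, h1, Submodule.quotEquivOfEq_mk]
    rfl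
  refine ⟨e, fun a y => ?_, ?_⟩
  · obtain ⟨x, rfl⟩ := hsV y
    rw [← vermaLift_act hv, he, he, vermaLift_act hw]
  · obtain ⟨ε, hε, hpar⟩ := hv.2.1.exists_smul
    obtain ⟨δ, hδ, hpar'⟩ := hw.2.1.exists_smul
    have key : ∀ y, e (V.par y) = (ε * δ) • W.par (e y) := by
      intro y
      obtain ⟨x, rfl⟩ := hsV y
      have hδδ : δ * δ = 1 := by rcases hδ with rfl | rfl <;> simp
      rw [vermaLift_par hpar, map_smul, he, he, vermaLift_par hpar', smul_smul, mul_assoc, hδδ,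
        mul_one]
    have hs : ε * δ = 1 ∨ ε * δ = -1 := by
      rcases hε with rfl | rfl <;> rcases hδ with rfl | rfl <;> simp
    rcases hs with hs | hs
    · exact Or.inl fun y => by rw [key, hs, one_smul]
    · exact Or.inr fun y => by rw [key, hs, neg_smul, one_smul]

/-- The weights of a lowest weight module are `-d, -d + 1, ...`. -/
theorem exists_eq_natCast_sub {V : SRep.{u}} {w : V} {d : ℝ} {m : ℂ}
    (h : V.IsLowestWeightVector d m w) (hw : V.orbit Set.univ {w} = ⊤) {x : V} (hx : x ≠ 0)
    {c : ℂ} (hc : V.act D x = c • x) : ∃ n : ℕ, c = n - d := by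
  obtain ⟨y, rfl⟩ := vermaLift_surjective h hw x
  let z : Bool × ℕ × ℕ →₀ ℂ × ℂ := y
  let f : (Bool × ℕ × ℕ →₀ ℂ × ℂ) →ₗ[ℂ] V := vermaLift d m V w
  have hD : ∀ n : ℕ, V.act D (f (z.filter fun b => level b = n)) =
      ((n : ℂ) - d) • f (z.filter fun b => level b = n) := fun n =>
    (vermaLift_act h D _).symm.trans
      ((congrArg f (vermaAct_D_filter d m coefPar (coefChi m) z n)).trans (map_smul f _ _))
  have hsum : ∑ n ∈ z.support.image level, f (z.filter fun b => level b = n) = f z := by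
    rw [← map_sum, sum_filter_level]
  have hz : f z ≠ 0 := hx
  obtain ⟨n, hn, hne⟩ := Finset.exists_ne_zero_of_sum_ne_zero (hsum ▸ hz)
  refine ⟨n, ?_⟩
  -- The `c`-eigenspace is itself stable under `D`, so it contains the level components of `x`; a
  -- nonzero one has both eigenvalues `c` and `n - d`.
  have hmem := mem_of_sum_eigenvectors_mem (V.act D)
    (LinearMap.ker (V.act D - c • LinearMap.id)) (fun x hx => by
      rw [LinearMap.mem_ker, LinearMap.sub_apply, sub_eq_zero] at hx ⊢
      rw [hx]; simp [hx]) _ (natCast_sub_injective d)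
    _ _ hD (by
      rw [hsum, LinearMap.mem_ker, LinearMap.sub_apply, sub_eq_zero]
      exact hc) n hn
  rw [LinearMap.mem_ker, LinearMap.sub_apply, sub_eq_zero, hD] at hmem
  exact (smul_left_injective ℂ hne hmem).symm

/-- The isomorphism carries each lowest weight vector to a weight vector of the other module, so `d'
- d` and `d - d'` are both natural numbers. -/
theorem IsLowestWeight.eq_of_isomorphic {V : SRep.{u}} {W : SRep.{v}} {d d' : ℝ} {m m' : ℂ}
    (hV : V.IsLowestWeight d m) (hW : W.IsLowestWeight d' m') (h : Isomorphic V W) :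
    d = d' ∧ m = m' := by
  obtain ⟨v, hv, hv'⟩ := hV
  obtain ⟨w, hw, hw'⟩ := hW
  obtain ⟨e, he, -⟩ := h
  have hev : e v ≠ 0 := by simpa using hv.1
  have hew : e.symm w ≠ 0 := by simpa using hw.1
  have he' : ∀ a x, e.symm (W.act a x) = V.act a (e.symm x) := by
    intro a x
    rw [LinearEquiv.symm_apply_eq, he, LinearEquiv.apply_symm_apply]
  constructor
  · obtain ⟨n, hn⟩ := exists_eq_natCast_sub hw hw' hev (c := -(d : ℂ))
      (by rw [← he, hv.2.2.2.2.1, map_smul])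
    obtain ⟨n', hn'⟩ := exists_eq_natCast_sub hv hv' hew (c := -(d' : ℂ))
      (by rw [← he', hw.2.2.2.2.1, map_smul])
    have h1 : -d = n - d' := by exact_mod_cast hn
    have h2 : -d' = n' - d := by exact_mod_cast hn'
    have h3 : (n : ℝ) + n' = 0 := by linarith
    have h4 : (0 : ℝ) ≤ n := Nat.cast_nonneg n
    have h5 : (0 : ℝ) ≤ n' := Nat.cast_nonneg n'
    linarith
  · have h1 : e (V.act M v) = W.act M (e v) := he M v
    rw [hv.2.2.2.2.2, W.M_eq_smul hw.2.2.2.2.2 hw', map_smul] at h1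
    exact smul_left_injective ℂ hev h1

theorem isTheIrreducible_of_irreducible {L : SRep.{v}} {d : ℝ} {m : ℂ} (h : L.Irreducible)
    (hL : L.IsLowestWeight d m) : IsTheIrreducible.{u} L d m :=
  ⟨h, hL, fun _ hV hVl => isomorphic_of_irreducible hV h hVl hL⟩

/-! ### Subspaces spanned by basis vectors -/

/-- A set of basis vectors of the Verma module that is closed under `G, K, S` spans a subspace
stable under `G, K, S`. -/
theorem supported_stable_plus {T : Type} [AddCommGroup T] [Module ℂ T] {d : ℝ} {m : ℂ}
    {σ χ : T →ₗ[ℂ] T} {A : Set (Bool × ℕ × ℕ)}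
    (hG : ∀ s k l, (s, k, l) ∈ A → (s, k + 1, l) ∈ A)
    (hK : ∀ s k l, (s, k, l) ∈ A → (s, k, l + 1) ∈ A)
    (hS : ∀ k l, (false, k, l) ∈ A → (true, k, l) ∈ A)
    (hS' : ∀ k l, (true, k, l) ∈ A → (false, k, l + 1) ∈ A) (a : Gen) (ha : a ∈ plus)
    (x : Bool × ℕ × ℕ →₀ T) (hx : x ∈ Finsupp.supported T ℂ A) :
    vermaAct d m σ χ a x ∈ Finsupp.supported T ℂ A := by
  have hbas : ∀ {s k l} (t : T), (s, k, l) ∈ A → bas s k l t ∈ Finsupp.supported T ℂ A :=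
    fun t h => Finsupp.single_mem_supported ℂ t h
  rw [← x.sum_single, Finsupp.sum, map_sum]
  refine Submodule.sum_mem _ fun b hb => ?_
  have hb : b ∈ A := hx hb
  obtain ⟨s, k, l⟩ := b
  change vermaAct d m σ χ a (bas s k l _) ∈ _
  rw [vermaAct_bas]
  simp only [plus, Set.mem_insert_iff, Set.mem_singleton_iff] at ha
  rcases ha with rfl | rfl | rfl <;> cases s
  · exact hbas _ (hG _ _ _ hb)
  · exact hbas _ (hG _ _ _ hb)
  · exact hbas _ (hK _ _ _ hb)
  · exact hbas _ (hK _ _ _ hb)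
  · exact hbas _ (hS _ _ hb)
  · exact Submodule.neg_mem _ (hbas _ (hS' _ _ hb))

theorem supported_le {T : Type*} [AddCommGroup T] [Module ℂ T] {A : Set (Bool × ℕ × ℕ)}
    {N : Submodule ℂ (Bool × ℕ × ℕ →₀ T)}
    (h : ∀ s k l t, (s, k, l) ∈ A → Finsupp.single (s, k, l) t ∈ N) :
    Finsupp.supported T ℂ A ≤ N := by
  intro x hx
  rw [← x.sum_single]
  exact Submodule.sum_mem _ fun b hb => h b.1 b.2.1 b.2.2 _ (hx hb)

/-! ### Mass zero: the quotient by `I^1` -/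

section Massless

/-- The vector `G^k K^l v₀` or `G^k K^l S v₀` of the massless Verma module. -/
noncomputable def verma₀Bas (d : ℝ) (s : Bool) (k l : ℕ) : verma₀ d :=
  (bas s k l 1 : Bool × ℕ × ℕ →₀ ℂ)

theorem single_eq_smul_verma₀Bas (d : ℝ) (s : Bool) (k l : ℕ) (t : ℂ) :
    (Finsupp.single (s, k, l) t : Bool × ℕ × ℕ →₀ ℂ) = t • verma₀Bas d s k l := by
  change _ = t • (Finsupp.single (s, k, l) (1 : ℂ) : Bool × ℕ × ℕ →₀ ℂ)
  simp

variable (d : ℝ) (s : Bool) (k l : ℕ)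

theorem par_verma₀Bas_false : (verma₀ d).par (verma₀Bas d false k l) = verma₀Bas d false k l :=
  (vermaPar_bas _ _ _ _ _).trans (one_smul ℂ _)

theorem par_verma₀Bas_true : (verma₀ d).par (verma₀Bas d true k l) = -verma₀Bas d true k l :=
  (vermaPar_bas _ _ _ _ _).trans (by rw [if_pos rfl, neg_smul, one_smul]; rfl)

theorem G_verma₀Bas : (verma₀ d).act G (verma₀Bas d s k l) = verma₀Bas d s (k + 1) l :=
  (vermaAct_bas _ _ _ _ _ _ _ _ _).trans (by cases s <;> rfl)

theorem K_verma₀Bas : (verma₀ d).act K (verma₀Bas d s k l) = verma₀Bas d s k (l + 1) :=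
  (vermaAct_bas _ _ _ _ _ _ _ _ _).trans (by cases s <;> rfl)

theorem S_verma₀Bas_false :
    (verma₀ d).act S (verma₀Bas d false k l) = verma₀Bas d true k l :=
  vermaAct_bas _ _ _ _ _ _ _ _ _

theorem S_verma₀Bas_true :
    (verma₀ d).act S (verma₀Bas d true k l) = -verma₀Bas d false k (l + 1) :=
  vermaAct_bas _ _ _ _ _ _ _ _ _

theorem M_verma₀Bas : (verma₀ d).act M (verma₀Bas d s k l) = 0 :=
  (vermaAct_bas _ _ _ _ _ _ _ _ _).trans (by cases s <;> exact zero_smul ℂ _)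

theorem D_verma₀Bas :
    (verma₀ d).act D (verma₀Bas d s k l) = ((level (s, k, l) : ℂ) - d) • verma₀Bas d s k l := by
  refine (vermaAct_bas _ _ _ _ _ _ _ _ _).trans ?_
  cases s
  · change ((k : ℂ) + 2 * l - d) • verma₀Bas d false k l = _
    congr 1
    simp [level]
  · change ((k : ℂ) + 2 * l + 1 - d) • verma₀Bas d true k l = _
    congr 1
    simp [level]

theorem Q_verma₀Bas_false :
    (verma₀ d).act Q (verma₀Bas d false k l) = (l : ℂ) • verma₀Bas d true k (l - 1) := by
  refine (vermaAct_bas _ _ _ _ _ _ _ _ _).trans ?_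
  simp [vermaActBasis]
  rfl

theorem Q_verma₀Bas_true :
    (verma₀ d).act Q (verma₀Bas d true k l) = ((d : ℂ) - l - k) • verma₀Bas d false k l := by
  refine (vermaAct_bas _ _ _ _ _ _ _ _ _).trans ?_
  simp [vermaActBasis]
  rfl

theorem P_verma₀Bas :
    (verma₀ d).act P (verma₀Bas d s k l) = (l : ℂ) • verma₀Bas d s (k + 1) (l - 1) := by
  refine (vermaAct_bas _ _ _ _ _ _ _ _ _).trans ?_
  cases s <;> simp [vermaActBasis] <;> rfl

theorem X_verma₀Bas_false : (verma₀ d).act X (verma₀Bas d false k l) = 0 := by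
  refine (vermaAct_bas _ _ _ _ _ _ _ _ _).trans ?_
  simp [vermaActBasis]
  rfl

theorem X_verma₀Bas_true :
    (verma₀ d).act X (verma₀Bas d true k l) = -verma₀Bas d false (k + 1) l := by
  refine (vermaAct_bas _ _ _ _ _ _ _ _ _).trans ?_
  simp [vermaActBasis]
  rfl

theorem H_verma₀Bas_false :
    (verma₀ d).act H (verma₀Bas d false k l) =
      ((l : ℂ) * (k + l - d - 1)) • verma₀Bas d false k (l - 1) := by
  refine (vermaAct_bas _ _ _ _ _ _ _ _ _).trans ?_
  simp [vermaActBasis]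
  rfl

theorem H_verma₀Bas_true :
    (verma₀ d).act H (verma₀Bas d true k l) =
      ((l : ℂ) * (k + l - d)) • verma₀Bas d true k (l - 1) := by
  refine (vermaAct_bas _ _ _ _ _ _ _ _ _).trans ?_
  simp [vermaActBasis]
  rfl

theorem verma₀Vec_isLowestWeightVector : (verma₀ d).IsLowestWeightVector d 0 (verma₀Vec d) := by
  refine ⟨?_, Or.inl (par_verma₀Bas_false d 0 0), ?_, ?_, ?_, ?_⟩
  · intro h
    have h1 : (bas false 0 0 1 : Bool × ℕ × ℕ →₀ ℂ) = 0 := h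
    simp [bas] at h1
  · exact (Q_verma₀Bas_false d 0 0).trans (by simp)
  · exact (P_verma₀Bas d false 0 0).trans (by simp)
  · exact (D_verma₀Bas d false 0 0).trans (by simp [level]; rfl)
  · exact (M_verma₀Bas d false 0 0).trans (zero_smul ℂ _).symm

theorem verma₀_eq_top_of_mem {d : ℝ} {N : Submodule ℂ (verma₀ d)}
    (hs : (verma₀ d).Stable plus N) (hv : verma₀Bas d false 0 0 ∈ N) : N = ⊤ := by
  refine verma_eq_top (T := ℂ) (d := d) (m := 0) (σ := LinearMap.id) (χ := 0)
    (fun t => rfl) (fun t => ?_) hs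
  have h := single_eq_smul_verma₀Bas d false 0 0 t
  change Finsupp.single (false, 0, 0) t ∈ N
  rw [h]
  exact N.smul_mem t hv

theorem verma₀Vec_orbit : (verma₀ d).orbit Set.univ {verma₀Vec d} = ⊤ :=
  verma₀_eq_top_of_mem (((verma₀ d).orbit_stable _ _).mono (Set.subset_univ _))
    ((verma₀ d).subset_orbit _ _ rfl)

/-- `G v₀` is singular exactly because the mass is zero: `P G v₀ = M v₀ = 0` and `Q G v₀ = X v₀ =
0`. -/
theorem singSub₀_space_eq_orbit :
    (singSub₀ d).space = (verma₀ d).orbit plus {(verma₀ d).act G (verma₀Vec d)} := by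
  have hG : (verma₀ d).act G (verma₀Vec d) = verma₀Bas d false 1 0 := G_verma₀Bas d false 0 0
  have hmem := (verma₀ d).subset_orbit plus {(verma₀ d).act G (verma₀Vec d)} rfl
  refine (verma₀ d).gen_eq_orbit_plus subset_rfl ((verma₀ d).subset_gen _) ?_ ?_
  · rintro _ rfl
    rw [hG, par_verma₀Bas_false, ← hG]
    exact hmem
  · rintro a ha _ rfl
    cases a
    case G => simp [plus] at ha
    case K => simp [plus] at ha
    case S => simp [plus] at ha
    all_goals
      rw [hG] at hmem ⊢
      simp only [H_verma₀Bas_false, P_verma₀Bas, D_verma₀Bas, M_verma₀Bas, Q_verma₀Bas_false,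
        X_verma₀Bas_false, Nat.cast_zero, zero_mul, zero_smul, Submodule.zero_mem]
    exact Submodule.smul_mem _ _ hmem

theorem singSub₀_space : (singSub₀ d).space = Finsupp.supported ℂ ℂ {b | b.2.1 ≠ 0} := by
  apply le_antisymm
  · rw [singSub₀_space_eq_orbit]
    refine (verma₀ d).orbit_le ?_ ?_
    · rintro _ rfl
      have hG : (verma₀ d).act G (verma₀Vec d) = verma₀Bas d false 1 0 := G_verma₀Bas d false 0 0
      rw [hG]
      exact Finsupp.single_mem_supported ℂ (1 : ℂ) (by simp)
    · exact supported_stable_plus (fun _ _ _ _ => by simp) (fun _ _ _ h => h) (fun _ _ h => h)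
        (fun _ _ h => h)
  · have hs := (singSub₀ d).stable
    have hG : verma₀Bas d false 1 0 ∈ (singSub₀ d).space := by
      rw [← G_verma₀Bas d false 0 0]
      exact (verma₀ d).subset_gen _ rfl
    have hK : ∀ s l, verma₀Bas d s 1 l ∈ (singSub₀ d).space := by
      intro s l
      induction l with
      | zero =>
        cases s
        · exact hG
        · rw [← S_verma₀Bas_false]
          exact hs S trivial _ hG
      | succ l ih =>
        rw [← K_verma₀Bas]
        exact hs K trivial _ ih
    have hk : ∀ s k l, verma₀Bas d s (k + 1) l ∈ (singSub₀ d).space := by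
      intro s k l
      induction k with
      | zero => exact hK s l
      | succ k ih =>
        rw [← G_verma₀Bas]
        exact hs G trivial _ ih
    refine supported_le fun s k l t hb => ?_
    obtain ⟨k, rfl⟩ := Nat.exists_eq_succ_of_ne_zero hb
    rw [single_eq_smul_verma₀Bas d]
    exact Submodule.smul_mem _ _ (hk s k l)

theorem verma₀Vec_notMem_singSub₀ : verma₀Vec d ∉ (singSub₀ d).space := by
  rw [singSub₀_space]
  intro h
  have h1 : (Finsupp.single (false, 0, 0) 1 : Bool × ℕ × ℕ →₀ ℂ) (false, 0, 0) = 0 :=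
    (Finsupp.mem_supported' ℂ _).mp h _ (by simp)
  simp at h1

theorem factor₀_isLowestWeight : (factor₀ d).IsLowestWeight d 0 :=
  ⟨_, SRep.isLowestWeightVector_proj _ _ (verma₀Vec_isLowestWeightVector d)
    (verma₀Vec_notMem_singSub₀ d), SRep.orbit_proj_eq_top _ _ _ (verma₀Vec_orbit d)⟩

/-- The coordinates along `K^l v₀` vanish on `I^1` and map the quotient onto `ℕ →₀ ℂ`. -/
theorem factor₀_not_finiteDimensional : ¬ FiniteDimensional ℂ (factor₀ d) := by
  intro h
  have hinj : Function.Injective fun l : ℕ => ((false, 0, l) : Bool × ℕ × ℕ) := by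
    intro l l' h
    simpa using h
  let f : verma₀ d →ₗ[ℂ] (ℕ →₀ ℂ) :=
    (Finsupp.lcomapDomain _ hinj : (Bool × ℕ × ℕ →₀ ℂ) →ₗ[ℂ] (ℕ →₀ ℂ))
  have hf : (singSub₀ d).space ≤ LinearMap.ker f := by
    rw [singSub₀_space]
    intro x hx
    rw [LinearMap.mem_ker]
    ext l
    exact (Finsupp.mem_supported' ℂ x).mp hx _ (by simp)
  have hsurj : Function.Surjective f := fun y =>
    ⟨(y.mapDomain fun l => ((false, 0, l) : Bool × ℕ × ℕ) : Bool × ℕ × ℕ →₀ ℂ),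
      Finsupp.comapDomain_mapDomain _ hinj y⟩
  have : FiniteDimensional ℂ (verma₀ d ⧸ (singSub₀ d).space) := h
  have hfin : Module.Finite ℂ (ℕ →₀ ℂ) :=
    Module.Finite.of_surjective ((singSub₀ d).space.liftQ f hf) fun y => by
      obtain ⟨x, rfl⟩ := hsurj y
      exact ⟨Submodule.Quotient.mk x, rfl⟩
  exact not_finite_iff_infinite.mpr inferInstance
    (Module.Finite.finite_basis (Finsupp.basisSingleOne (R := ℂ) (ι := ℕ)))

variable {d}

/-- Modulo `I^1` the weight spaces are at most one-dimensional. -/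
theorem verma₀Bas_mem_of_coef_ne_zero {N : Submodule ℂ (verma₀ d)}
    (hs : (verma₀ d).Stable osp N) (hN : (singSub₀ d).space ≤ N) {x : Bool × ℕ × ℕ →₀ ℂ}
    (hx : x ∈ N) {s : Bool} {l : ℕ} (h : x (s, 0, l) ≠ 0) : verma₀Bas d s 0 l ∈ N := by
  have h1 := filter_level_mem (d := d) (m := 0) (σ := LinearMap.id) (χ := 0) (N := N)
    (hs D (by simp [osp])) hx (level (s, 0, l))
  -- Without `G` the level is `2l` or `2l + 1`, which determines the basis vector; the other terms
  -- of this level contain `G` and lie in `I^1`.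
  have h2 : x.filter (fun b => level b = level (s, 0, l)) -
      Finsupp.single (s, 0, l) (x (s, 0, l)) ∈ Finsupp.supported ℂ ℂ {b | b.2.1 ≠ 0} := by
    rw [Finsupp.mem_supported']
    rintro ⟨s', k, l'⟩ hb
    obtain rfl : k = 0 := by simpa using hb
    have hlev : level (s', 0, l') = level (s, 0, l) ↔ (s, 0, l) = (s', 0, l') := by
      cases s <;> cases s' <;> simp [level] <;> omega
    rw [Finsupp.sub_apply, Finsupp.filter_apply, Finsupp.single_apply]
    simp only [hlev]
    split_ifs with h
    · rw [h, sub_self]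
    · simp
  rw [← singSub₀_space d] at h2
  have h3 : Finsupp.single (s, 0, l) (x (s, 0, l)) ∈ N :=
    (N.sub_mem_iff_right h1).mp (hN h2)
  rw [single_eq_smul_verma₀Bas d] at h3
  exact (N.smul_mem_iff h).mp h3

theorem verma₀Bas_true_mem {N : Submodule ℂ (verma₀ d)} (hs : (verma₀ d).Stable osp N) {l : ℕ}
    (h : verma₀Bas d false 0 (l + 1) ∈ N) : verma₀Bas d true 0 l ∈ N := by
  have h1 := hs Q (by simp [osp]) _ h
  rw [Q_verma₀Bas_false] at h1
  exact (N.smul_mem_iff (Nat.cast_ne_zero.mpr l.succ_ne_zero)).mp h1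

/-- `Q K^l S v₀ = (d - l) K^l v₀`: this is the only step of the descent that can fail, and it makes
the natural numbers exceptional. -/
theorem verma₀Bas_false_mem {N : Submodule ℂ (verma₀ d)} (hs : (verma₀ d).Stable osp N) {l : ℕ}
    (hl : d ≠ l) (h : verma₀Bas d true 0 l ∈ N) : verma₀Bas d false 0 l ∈ N := by
  have h1 := hs Q (by simp [osp]) _ h
  rw [Q_verma₀Bas_true] at h1
  refine (N.smul_mem_iff ?_).mp h1
  rw [Nat.cast_zero, sub_zero, sub_ne_zero]
  exact_mod_cast hl

theorem verma₀Bas_zero_mem {N : Submodule ℂ (verma₀ d)} (hs : (verma₀ d).Stable osp N) {l : ℕ}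
    (hl : ∀ j < l, d ≠ j) (h : verma₀Bas d false 0 l ∈ N) : verma₀Bas d false 0 0 ∈ N := by
  induction l with
  | zero => exact h
  | succ l ih =>
    exact ih (fun j hj => hl j (hj.trans (Nat.lt_succ_self l)))
      (verma₀Bas_false_mem hs (hl l (Nat.lt_succ_self l)) (verma₀Bas_true_mem hs h))

/-- A subspace that contains `I^1`, is stable under `osp(1/2)`, and has an element with a component
from which one can descend to `v₀`, is the whole module. -/
theorem verma₀_eq_top_of_coef_ne_zero {N : Submodule ℂ (verma₀ d)}
    (hs : (verma₀ d).Stable osp N) (hN : (singSub₀ d).space ≤ N) {x : Bool × ℕ × ℕ →₀ ℂ}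
    (hx : x ∈ N) {s : Bool} {l : ℕ} (h : x (s, 0, l) ≠ 0) (hl : ∀ j < l + s.toNat, d ≠ j) :
    N = ⊤ := by
  have h1 : verma₀Bas d false 0 0 ∈ N := by
    have h2 := verma₀Bas_mem_of_coef_ne_zero hs hN hx h
    cases s
    · exact verma₀Bas_zero_mem hs hl h2
    · exact verma₀Bas_zero_mem hs (fun j hj => hl j (hj.trans (Nat.lt_succ_self l)))
        (verma₀Bas_false_mem hs (hl l (Nat.lt_succ_self l)) h2)
  have hK : ∀ s l, verma₀Bas d s 0 l ∈ N := by
    intro s l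
    induction l with
    | zero =>
      cases s
      · exact h1
      · rw [← S_verma₀Bas_false]
        exact hs S (by simp [osp]) _ h1
    | succ l ih =>
      rw [← K_verma₀Bas]
      exact hs K (by simp [osp]) _ ih
  rw [eq_top_iff]
  intro x _
  have hle : Finsupp.supported ℂ ℂ Set.univ ≤ N := by
    refine supported_le fun s k l t _ => ?_
    rcases Nat.eq_zero_or_pos k with rfl | hk
    · rw [single_eq_smul_verma₀Bas d]
      exact N.smul_mem t (hK s l)
    · refine hN ?_
      rw [singSub₀_space]
      exact Finsupp.single_mem_supported ℂ t hk.ne'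
  exact hle ((Finsupp.mem_supported' ℂ _).mpr fun b hb => (hb trivial).elim)

theorem factor₀_irreducibleUnder_osp (hd : ∀ p : ℕ, d ≠ p) :
    (factor₀ d).IrreducibleUnder osp := by
  refine SRep.irreducibleUnder_quot _ _ _ ?_ fun N _ hs hN => ?_
  · intro h
    exact verma₀Vec_notMem_singSub₀ d (h ▸ Submodule.mem_top)
  · by_cases h : ∃ x : Bool × ℕ × ℕ →₀ ℂ, x ∈ N ∧ ∃ s l, x (s, 0, l) ≠ 0
    · obtain ⟨x, hx, s, l, h⟩ := h
      exact Or.inr (verma₀_eq_top_of_coef_ne_zero hs hN hx h fun j _ => hd j)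
    · push Not at h
      left
      rw [singSub₀_space]
      intro x hx
      refine (Finsupp.mem_supported' ℂ x).mpr ?_
      rintro ⟨s, k, l⟩ hb
      obtain rfl : k = 0 := by simpa using hb
      exact h x hx s l

end Massless

/-! ### Mass zero, `d = p`: the finite-dimensional quotient -/

section MasslessQuotient

variable (p : ℕ)

/-- The projection of the massless Verma module onto `V^d / I^1`. -/
noncomputable def factor₀Proj (d : ℝ) : verma₀ d →ₗ[ℂ] factor₀ d :=
  (verma₀ d).proj (singSub₀ d)

theorem factor₀Proj_act (d : ℝ) (a : Gen) (x : verma₀ d) :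
    factor₀Proj d ((verma₀ d).act a x) = (factor₀ d).act a (factor₀Proj d x) :=
  rfl

theorem factor₀Proj_par (d : ℝ) (x : verma₀ d) :
    factor₀Proj d ((verma₀ d).par x) = (factor₀ d).par (factor₀Proj d x) :=
  rfl

theorem factor₀Proj_eq_zero_iff (d : ℝ) (x : verma₀ d) :
    factor₀Proj d x = 0 ↔ x ∈ (singSub₀ d).space :=
  SRep.proj_eq_zero _ _ _

theorem factor₀Proj_surjective (d : ℝ) : Function.Surjective (factor₀Proj d) :=
  (singSub₀ d).space.mkQ_surjective

theorem factor₀Proj_verma₀Bas_succ (d : ℝ) (s : Bool) (k l : ℕ) :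
    factor₀Proj d (verma₀Bas d s (k + 1) l) = 0 := by
  rw [factor₀Proj_eq_zero_iff, singSub₀_space]
  exact Finsupp.single_mem_supported ℂ (1 : ℂ) (by simp)

theorem singVec₁_eq : singVec₁ p = factor₀Proj p (verma₀Bas p true 0 p) := by
  have h : ∀ n : ℕ, ((factor₀ p).act K ^ n) (factor₀Proj p (verma₀Bas p true 0 0)) =
      factor₀Proj p (verma₀Bas p true 0 n) := by
    intro n
    induction n with
    | zero => rfl
    | succ n ih =>
      rw [pow_succ', Module.End.mul_apply, ih, ← factor₀Proj_act, K_verma₀Bas]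
  rw [← h p]
  refine congrArg ((factor₀ p).act K ^ p) ?_
  exact (factor₀Proj_act p S (verma₀Bas p false 0 0)).symm.trans (by rw [S_verma₀Bas_false])

/-- For `d = p` the coefficients `d - p` of `Q` and `p (p - d)` of `H` on `K^p S w₀` vanish, while
`P` and `X` produce a factor `G`, which is zero modulo `I^1`. -/
theorem singSub₁_space_eq_orbit :
    (singSub₁ p).space = (factor₀ p).orbit plus {singVec₁ p} := by
  have hmem : singVec₁ p ∈ (factor₀ p).orbit plus {singVec₁ p} :=
    (factor₀ p).subset_orbit plus {singVec₁ p} rfl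
  refine (factor₀ p).gen_eq_orbit_plus subset_rfl ((factor₀ p).subset_gen _) ?_ ?_
  · rintro _ rfl
    have : (factor₀ p).par (singVec₁ p) = -singVec₁ p := by
      rw [singVec₁_eq, ← factor₀Proj_par, par_verma₀Bas_true, map_neg]
    rw [this]
    exact Submodule.neg_mem _ hmem
  · rintro a ha _ rfl
    have h1 := factor₀Proj_verma₀Bas_succ p true 0 (p - 1)
    have h2 := factor₀Proj_verma₀Bas_succ p false 0 p
    cases a
    case G => simp [plus] at ha
    case K => simp [plus] at ha
    case S => simp [plus] at ha
    all_goals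
      rw [singVec₁_eq] at hmem ⊢
      rw [← factor₀Proj_act]
      simp only [H_verma₀Bas_true, P_verma₀Bas, D_verma₀Bas, M_verma₀Bas, Q_verma₀Bas_true,
        X_verma₀Bas_true, map_smul, map_neg, map_zero, h1, h2, smul_zero, neg_zero,
        Submodule.zero_mem]
    · simp
    · exact Submodule.smul_mem _ _ hmem
    · simp

/-- The indices of the basis vectors of `V^p` that vanish in the irreducible quotient. -/
def vanishing : Set (Bool × ℕ × ℕ) := {b | b.2.1 ≠ 0 ∨ 2 * p + 1 ≤ level b}

/-- `K^p S w₀` sits at level `2p + 1`, and `K` and `S` carry it, up to sign, through every basis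
vector of higher level without `G`. -/
theorem factor₀Proj_mem_singSub₁_iff (x : verma₀ p) :
    factor₀Proj p x ∈ (singSub₁ p).space ↔
      x ∈ Finsupp.supported ℂ ℂ (vanishing p) := by
  constructor
  · intro h
    have hle : (singSub₁ p).space ≤
        (Finsupp.supported ℂ ℂ (vanishing p)).map (factor₀Proj p) := by
      rw [singSub₁_space_eq_orbit]
      refine (factor₀ p).orbit_le ?_ ?_
      · rintro _ rfl
        rw [singVec₁_eq]
        refine ⟨_, Finsupp.single_mem_supported ℂ (1 : ℂ) ?_, rfl⟩
        simp [vanishing, level]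
      · rintro a ha _ ⟨y, hy, rfl⟩
        refine ⟨_, supported_stable_plus (d := p) (m := 0) (σ := LinearMap.id) (χ := 0)
          ?_ ?_ ?_ ?_ a ha y hy, rfl⟩ <;> intros <;>
          simp_all [vanishing, level] <;> omega
    obtain ⟨y, hy, hxy⟩ := hle h
    have h1 : x - y ∈ (singSub₀ p).space := by
      rw [← factor₀Proj_eq_zero_iff, map_sub, hxy, sub_self]
    rw [singSub₀_space] at h1
    have h2 : x - y ∈ (Finsupp.supported ℂ ℂ (vanishing p) : Submodule ℂ (verma₀ p)) :=
      Finsupp.supported_mono (fun b hb => Or.inl hb) h1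
    exact (Submodule.sub_mem_iff_left _ hy).mp h2
  · intro h
    have hs := (singSub₁ p).stable
    have htrue : ∀ j, factor₀Proj p (verma₀Bas p true 0 (p + j)) ∈ (singSub₁ p).space := by
      intro j
      induction j with
      | zero =>
        rw [add_zero, ← singVec₁_eq]
        exact (factor₀ p).subset_gen _ rfl
      | succ j ih =>
        have := hs K trivial _ ih
        rw [← factor₀Proj_act, K_verma₀Bas] at this
        exact this
    have hfalse : ∀ j, factor₀Proj p (verma₀Bas p false 0 (p + j + 1)) ∈ (singSub₁ p).space := by
      intro j
      have := hs S trivial _ (htrue j)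
      rw [← factor₀Proj_act, S_verma₀Bas_true, map_neg] at this
      exact (Submodule.neg_mem_iff _).mp this
    have hle : Finsupp.supported ℂ ℂ (vanishing p) ≤
        (singSub₁ p).space.comap (factor₀Proj p) := by
      refine supported_le fun s k l t hb => ?_
      rw [single_eq_smul_verma₀Bas p]
      refine Submodule.smul_mem _ _ ?_
      change factor₀Proj p (verma₀Bas p s k l) ∈ (singSub₁ p).space
      rcases k with _ | k
      · cases s
        · obtain ⟨j, rfl⟩ : ∃ j, l = p + j + 1 :=
            ⟨l - p - 1, by simp [vanishing, level] at hb; omega⟩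
          exact hfalse j
        · obtain ⟨j, rfl⟩ : ∃ j, l = p + j :=
            ⟨l - p, by simp [vanishing, level] at hb; omega⟩
          exact htrue j
      · rw [factor₀Proj_verma₀Bas_succ]
        exact Submodule.zero_mem _
    exact hle h

theorem proj_verma₀Vec_notMem_singSub₁ :
    factor₀Proj p (verma₀Vec p) ∉ (singSub₁ p).space := by
  intro h
  have h1 : (Finsupp.single (false, 0, 0) 1 : Bool × ℕ × ℕ →₀ ℂ) (false, 0, 0) = 0 :=
    (Finsupp.mem_supported' ℂ _).mp ((factor₀Proj_mem_singSub₁_iff p _).mp h) _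
      (by simp [vanishing, level])
  simp at h1

theorem factor₀_quot_isLowestWeight : ((factor₀ p).quot (singSub₁ p)).IsLowestWeight p 0 :=
  ⟨_, SRep.isLowestWeightVector_proj (factor₀ p) _ (SRep.isLowestWeightVector_proj _ _
      (verma₀Vec_isLowestWeightVector p) (verma₀Vec_notMem_singSub₀ p))
      (proj_verma₀Vec_notMem_singSub₁ p),
    SRep.orbit_proj_eq_top (factor₀ p) _ _ (SRep.orbit_proj_eq_top _ _ _ (verma₀Vec_orbit p))⟩

theorem factor₀_quot_irreducibleUnder_osp :
    ((factor₀ p).quot (singSub₁ p)).IrreducibleUnder osp := by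
  refine SRep.irreducibleUnder_quot _ _ _ ?_ fun N _ hs hN => ?_
  · intro h
    exact proj_verma₀Vec_notMem_singSub₁ p (h ▸ Submodule.mem_top)
  · let N' : Submodule ℂ (verma₀ p) := N.comap (factor₀Proj p)
    have hs' : (verma₀ p).Stable osp N' := fun a ha x hx => hs a ha _ hx
    have hN' : (singSub₀ p).space ≤ N' := by
      intro x hx
      change factor₀Proj p x ∈ N
      rw [(factor₀Proj_eq_zero_iff _ _).mpr hx]
      exact N.zero_mem
    by_cases h : ∃ x : Bool × ℕ × ℕ →₀ ℂ, x ∈ N' ∧ x ∉ Finsupp.supported ℂ ℂ (vanishing p)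
    · obtain ⟨x, hx, h⟩ := h
      rw [Finsupp.mem_supported'] at h
      push Not at h
      obtain ⟨⟨s, k, l⟩, hb, h⟩ := h
      simp only [vanishing, Set.mem_ofPred_eq, not_or, not_not, not_le] at hb
      obtain ⟨rfl, hb⟩ := hb
      -- A descent starting at level at most `2p` meets only the factors `p - j` with `j < p`.
      have htop : N' = ⊤ := verma₀_eq_top_of_coef_ne_zero hs' hN' hx h fun j hj => by
        have : j < p := by
          cases s <;> simp [level] at hb hj <;> omega
        exact_mod_cast this.ne'
      right
      rw [eq_top_iff]
      intro y _
      obtain ⟨x, rfl⟩ := factor₀Proj_surjective p y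
      have : x ∈ N' := htop ▸ Submodule.mem_top
      exact this
    · push Not at h
      left
      intro y hy
      obtain ⟨x, rfl⟩ := factor₀Proj_surjective p y
      exact (factor₀Proj_mem_singSub₁_iff p x).mpr (h x hy)

/-- The coordinates on the irreducible quotient of `V^p`. -/
noncomputable def quotCoord : verma₀ p →ₗ[ℂ] (Fin (2 * p + 1) → ℂ) :=
  -- The index `i` is the level: `i = 2l + s` with `s = bodd i` and `l = div2 i`.
  (LinearMap.pi fun i => Finsupp.lapply (i.1.bodd, 0, i.1.div2) :
    (Bool × ℕ × ℕ →₀ ℂ) →ₗ[ℂ] (Fin (2 * p + 1) → ℂ))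

theorem quotCoord_surjective : Function.Surjective (quotCoord p) := by
  intro g
  have hinj : Function.Injective fun i : Fin (2 * p + 1) =>
      ((i.1.bodd, 0, i.1.div2) : Bool × ℕ × ℕ) := by
    intro i j h
    simp only [Prod.mk.injEq, true_and] at h
    rw [Fin.ext_iff, ← Nat.bit_bodd_div2 i.1, ← Nat.bit_bodd_div2 j.1, h.1, h.2]
  refine ⟨(∑ i, Finsupp.single (i.1.bodd, 0, i.1.div2) (g i) : Bool × ℕ × ℕ →₀ ℂ), ?_⟩
  ext j
  change (∑ i, Finsupp.single (i.1.bodd, 0, i.1.div2) (g i) : Bool × ℕ × ℕ →₀ ℂ)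
    (j.1.bodd, 0, j.1.div2) = g j
  rw [Finsupp.finsetSum_apply]
  simp only [Finsupp.single_apply]
  have : ∀ i : Fin (2 * p + 1), (((i.1.bodd, 0, i.1.div2) : Bool × ℕ × ℕ) =
    (j.1.bodd, 0, j.1.div2)) ↔ i = j := fun i => hinj.eq_iff
  simp only [this, Finset.sum_ite_eq', Finset.mem_univ, if_true]

theorem ker_quotCoord : LinearMap.ker (quotCoord p) = Finsupp.supported ℂ ℂ (vanishing p) := by
  ext x
  rw [LinearMap.mem_ker]
  refine Iff.trans ?_ (Finsupp.mem_supported' ℂ _).symm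
  constructor
  · rintro h ⟨s, k, l⟩ hb
    simp only [vanishing, Set.mem_ofPred_eq, not_or, not_not, not_le] at hb
    obtain ⟨rfl, hb⟩ := hb
    have hlt : Nat.bit s l < 2 * p + 1 := by
      cases s <;> simp [level] at hb ⊢ <;> omega
    have h1 := congrFun h ⟨Nat.bit s l, hlt⟩
    change (show Bool × ℕ × ℕ →₀ ℂ from x) ((Nat.bit s l).bodd, 0, (Nat.bit s l).div2) = 0 at h1
    rwa [Nat.bodd_bit, Nat.div2_bit] at h1
  · intro h
    ext i
    refine h _ ?_
    have h1 := Nat.bodd_add_div2 i.1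
    have h2 := i.2
    simp only [vanishing, level, Set.mem_ofPred_eq, not_or, not_not, not_le]
    cases hb : i.1.bodd <;> rw [hb] at h1 <;> simp at h1 ⊢ <;> omega

/-- The irreducible quotient of `V^p` has dimension `2 p + 1`. -/
noncomputable def factor₀QuotEquiv :
    (factor₀ p).quot (singSub₁ p) ≃ₗ[ℂ] (Fin (2 * p + 1) → ℂ) :=
  let π : verma₀ p →ₗ[ℂ] (factor₀ p).quot (singSub₁ p) :=
    (factor₀ p).proj (singSub₁ p) ∘ₗ factor₀Proj p
  have hπ : Function.Surjective π :=
    (singSub₁ p).space.mkQ_surjective.comp (factor₀Proj_surjective p)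
  have hker : LinearMap.ker π = LinearMap.ker (quotCoord p) := by
    rw [ker_quotCoord]
    ext x
    rw [LinearMap.mem_ker]
    exact ((factor₀ p).proj_eq_zero (singSub₁ p) _).trans (factor₀Proj_mem_singSub₁_iff p x)
  (π.quotKerEquivOfSurjective hπ).symm ≪≫ₗ Submodule.quotEquivOfEq _ _ hker ≪≫ₗ
    (quotCoord p).quotKerEquivOfSurjective (quotCoord_surjective p)

end MasslessQuotient

/-! ### Nonzero mass: the operator `G² - 2mK` and the Heisenberg relation -/

namespace SRep

/-- The operator `G² - 2 m K`. -/
noncomputable def reducedK (V : SRep.{u}) (m : ℂ) : V →ₗ[ℂ] V :=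
  V.act G ^ 2 - (2 * m) • V.act K

section Mass

variable (V : SRep.{u}) {m : ℂ}

theorem reducedK_apply (x : V) :
    V.reducedK m x = V.act G (V.act G x) - (2 * m) • V.act K x := by
  simp [reducedK, pow_two]

theorem reducedK_par (x : V) : V.par (V.reducedK m x) = V.reducedK m (V.par x) := by
  simp [reducedK_apply, V.par_act, degree]

theorem X_reducedK (x : V) : V.act X (V.reducedK m x) = V.reducedK m (V.act X x) := by
  simp [reducedK_apply, V.X_G, V.X_K]

theorem S_reducedK (x : V) : V.act S (V.reducedK m x) = V.reducedK m (V.act S x) := by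
  simp [reducedK_apply, V.S_G, V.S_K]

theorem G_reducedK (x : V) : V.act G (V.reducedK m x) = V.reducedK m (V.act G x) := by
  simp [reducedK_apply, V.G_K]

theorem D_reducedK (x : V) :
    V.act D (V.reducedK m x) = V.reducedK m (V.act D x) + (2 : ℂ) • V.reducedK m x := by
  simp only [reducedK_apply, map_sub, map_smul, V.D_G, V.D_K, map_add]
  module

/-- `[P, G²] = 2mG` and `[P, K] = G`, which fixes the coefficient `2m`: the operator preserves the
kernel of `P`. -/
theorem P_reducedK (hM : ∀ x, V.act M x = m • x) (x : V) :
    V.act P (V.reducedK m x) = V.reducedK m (V.act P x) := by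
  simp only [reducedK_apply, map_sub, map_smul, V.P_G, V.P_K, map_add, hM]
  module

theorem Q_reducedK (x : V) :
    V.act Q (V.reducedK m x) = V.reducedK m (V.act Q x) +
      ((2 : ℂ) • V.act G (V.act X x) - (2 * m) • V.act S x) := by
  simp only [reducedK_apply, map_sub, map_smul, V.Q_G, V.Q_K, map_add, V.X_G]
  module

theorem reducedK_mem {N : Submodule ℂ V} (h : V.Stable plus N) {x : V} (hx : x ∈ N) :
    V.reducedK m x ∈ N := by
  rw [reducedK_apply]
  have hG := h G (by simp [plus])
  exact N.sub_mem (hG _ (hG _ hx)) (N.smul_mem _ (h K (by simp [plus]) _ hx))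

theorem P_pow_succ_G (hM : ∀ x, V.act M x = m • x) (n : ℕ) (x : V) :
    (V.act P ^ (n + 1)) (V.act G x) =
      V.act G ((V.act P ^ (n + 1)) x) + (((n : ℂ) + 1) * m) • (V.act P ^ n) x := by
  induction n generalizing x with
  | zero => simp [V.P_G, hM]
  | succ n ih =>
    have e : ∀ j y, (V.act P ^ j) (V.act P y) = (V.act P ^ (j + 1)) y := fun j y => by
      rw [pow_succ, Module.End.mul_apply]
    rw [← e, V.P_G, map_add, ih, hM, map_smul, e, e]
    push_cast
    module

/-- In a module of nonzero mass on which `P` is locally nilpotent, a submodule is determined by its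
vectors killed by `P`. -/
theorem le_of_inf_ker_P_le (hm : m ≠ 0) (hM : ∀ x, V.act M x = m • x)
    (hnil : ∀ x, ∃ n, (V.act P ^ n) x = 0) {N I : Submodule ℂ V}
    (hN : V.Stable Set.univ N) (hI : V.Stable plus I)
    (h : ∀ x ∈ N, V.act P x = 0 → x ∈ I) : N ≤ I := by
  have key : ∀ n, ∀ x ∈ N, (V.act P ^ n) x = 0 → x ∈ I := by
    intro n
    induction n with
    | zero =>
      intro x _ hx
      rw [pow_zero, Module.End.one_apply] at hx
      rw [hx]
      exact I.zero_mem
    | succ n ih =>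
      intro x hxN hx
      rcases n with _ | n
      · exact h x hxN (by simpa using hx)
      · have hP : V.act P x ∈ I := ih _ (hN P trivial x hxN) (by
          rwa [pow_succ, Module.End.mul_apply] at hx)
        have hGP := hI G (by simp [plus]) _ hP
        have hc : ((n : ℂ) + 1) * m ≠ 0 := mul_ne_zero (Nat.cast_add_one_ne_zero n) hm
        -- As `P^(n+2) x = 0`, one has `P^(n+1) G P x = (n + 1) m P^(n+1) x`, so the corrected
        -- vector is killed by `P^(n+1)`; the correction lies in `I` by induction applied to `P x`.
        have hy : x - (((n : ℂ) + 1) * m)⁻¹ • V.act G (V.act P x) ∈ I := by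
          refine ih _ (N.sub_mem hxN (N.smul_mem _ (hN G trivial _ (hN P trivial _ hxN)))) ?_
          rw [map_sub, map_smul, V.P_pow_succ_G hM]
          rw [pow_succ, Module.End.mul_apply] at hx
          rw [hx, map_zero, zero_add, smul_smul, inv_mul_cancel₀ hc, one_smul, pow_succ,
            Module.End.mul_apply, sub_self]
        have := I.add_mem hy (I.smul_mem (((n : ℂ) + 1) * m)⁻¹ hGP)
        rwa [sub_add_cancel] at this
  intro x hx
  obtain ⟨n, hn⟩ := hnil x
  exact key n x hx hn

end Mass

end SRep

/-! ### Nonzero mass: the action of `P` on the Verma module -/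

section Massive

variable (d : ℝ) (m : ℂ)

theorem verma_M (x : verma d m) : (verma d m).act M x = m • x :=
  (verma d m).M_eq_smul (vermaVec_isLowestWeightVector d m).2.2.2.2.2 (vermaVec_orbit d m) x

theorem mem_maxGenEigenspace_zero {W : Type*} [AddCommGroup W] [Module ℂ W] (f : W →ₗ[ℂ] W)
    (x : W) : x ∈ Module.End.maxGenEigenspace f 0 ↔ ∃ n, (f ^ n) x = 0 := by
  simp [Module.End.mem_maxGenEigenspace]

/-- The generalized kernel of `P` contains all `t v₀` and is stable under any operator whose
commutator with `P` preserves it. The commutators are `0` for `X`, `m` for `G`, then `G` for `K` and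
`X` for `S`. -/
theorem verma_P_nilpotent (x : verma d m) : ∃ n, ((verma d m).act P ^ n) x = 0 := by
  let N : Submodule ℂ (verma d m) := Module.End.maxGenEigenspace ((verma d m).act P) 0
  have hN : ∀ x, x ∈ N ↔ ∃ n, ((verma d m).act P ^ n) x = 0 := mem_maxGenEigenspace_zero _
  have hP : ∀ x, (verma d m).act P x ∈ N → x ∈ N := by
    intro x hx
    obtain ⟨n, hn⟩ := (hN _).mp hx
    exact (hN _).mpr ⟨n + 1, by rw [pow_succ]; exact hn⟩
  have hX : ∀ x ∈ N, (verma d m).act X x ∈ N := by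
    intro x hx
    obtain ⟨n, hn⟩ := (hN _).mp hx
    have hc : Commute ((verma d m).act P) ((verma d m).act X) := LinearMap.ext fun x => (verma d m).P_X x
    refine (hN _).mpr ⟨n, ?_⟩
    have := LinearMap.congr_fun (hc.pow_left n).eq x
    rw [Module.End.mul_apply, Module.End.mul_apply, hn, map_zero] at this
    exact this
  have hind : ∀ f : verma d m →ₗ[ℂ] verma d m, (∀ x ∈ N, (verma d m).act P (f x) - f ((verma d m).act P x) ∈ N) →
      ∀ x ∈ N, f x ∈ N := by
    intro f hf x hx
    obtain ⟨n, hn⟩ := (hN x).mp hx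
    induction n generalizing x with
    | zero =>
      rw [pow_zero, Module.End.one_apply] at hn
      rw [hn, map_zero]
      exact N.zero_mem
    | succ n ih =>
      rw [pow_succ, Module.End.mul_apply] at hn
      have h1 := ih _ ((hN _).mpr ⟨n, hn⟩) hn
      refine hP _ ?_
      have := N.add_mem (hf x hx) h1
      rwa [sub_add_cancel] at this
  have hG : ∀ x ∈ N, (verma d m).act G x ∈ N := hind _ fun x hx => by
    rw [(verma d m).P_G, add_sub_cancel_left, verma_M]
    exact N.smul_mem _ hx
  have htop : N = ⊤ := by
    refine verma_eq_top_of_stable_plus (fun t => ?_) ?_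
    · exact (hN _).mpr ⟨1, by rw [pow_one]; exact P_vermaBas_zero d m t⟩
    · intro a ha
      simp only [plus, Set.mem_insert_iff, Set.mem_singleton_iff] at ha
      rcases ha with rfl | rfl | rfl
      · exact hG
      · exact hind _ fun x hx => by
          rw [(verma d m).P_K, add_sub_cancel_left]
          exact hG x hx
      · exact hind _ fun x hx => by
          rw [(verma d m).P_S, add_sub_cancel_left]
          exact hX x hx
  exact (hN x).mp (htop ▸ Submodule.mem_top)

/-- A coordinate on the Verma module. -/
noncomputable def vermaCoord (b : Bool × ℕ × ℕ) : verma d m →ₗ[ℂ] ℂ × ℂ :=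
  (Finsupp.lapply b : (Bool × ℕ × ℕ →₀ ℂ × ℂ) →ₗ[ℂ] ℂ × ℂ)

variable {d m}

theorem vermaCoord_vermaBas (b : Bool × ℕ × ℕ) (s : Bool) (k l : ℕ) (t : ℂ × ℂ) :
    vermaCoord d m b (vermaBas d m s k l t) = if (s, k, l) = b then t else 0 :=
  Finsupp.single_apply

theorem verma_ext_coord {x y : verma d m} (h : ∀ b, vermaCoord d m b x = vermaCoord d m b y) :
    x = y :=
  Finsupp.ext h

theorem vermaCoord_D (b : Bool × ℕ × ℕ) (x : verma d m) :
    vermaCoord d m b ((verma d m).act D x) = ((level b : ℂ) - d) • vermaCoord d m b x :=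
  vermaAct_D_apply d m coefPar (coefChi m) x b

theorem vermaCoord_eq_zero_of_level {x : verma d m} {n : ℕ}
    (hx : (verma d m).act D x = ((n : ℂ) - d) • x) {b : Bool × ℕ × ℕ} (hb : level b ≠ n) :
    vermaCoord d m b x = 0 := by
  have h := vermaCoord_D b x
  rw [hx, map_smul, ← sub_eq_zero, ← sub_smul, smul_eq_zero] at h
  refine h.resolve_left fun e => hb ?_
  have : (n : ℂ) = level b := by linear_combination e
  exact_mod_cast this.symm

/-- A subspace stable under `D` is spanned by its weight vectors. -/
theorem verma_le_of_weight_vectors {N I : Submodule ℂ (verma d m)}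
    (hN : ∀ x ∈ N, (verma d m).act D x ∈ N)
    (h : ∀ (n : ℕ), ∀ x ∈ N, (verma d m).act D x = ((n : ℂ) - d) • x → x ∈ I) : N ≤ I := by
  intro x hx
  let z : Bool × ℕ × ℕ →₀ ℂ × ℂ := x
  have h1 : ∑ n ∈ z.support.image level, z.filter (fun b => level b = n) ∈ I :=
    Submodule.sum_mem I fun n _ => h n _
      (filter_level_mem (d := d) (m := m) (σ := coefPar) (χ := coefChi m) (N := N) hN hx n)
      (vermaAct_D_filter d m coefPar (coefChi m) z n)
  rwa [sum_filter_level] at h1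

theorem vermaCoord_G_zero (s : Bool) (l : ℕ) (x : verma d m) :
    vermaCoord d m (s, 0, l) ((verma d m).act G x) = 0 := by
  have h : vermaCoord d m (s, 0, l) ∘ₗ (verma d m).act G = 0 := verma_ext fun s' k' l' t => by
    rw [LinearMap.comp_apply, G_vermaBas, vermaCoord_vermaBas]
    simp
  exact LinearMap.congr_fun h x

theorem vermaCoord_K_succ (s : Bool) (k l : ℕ) (x : verma d m) :
    vermaCoord d m (s, k, l + 1) ((verma d m).act K x) = vermaCoord d m (s, k, l) x := by
  have h : vermaCoord d m (s, k, l + 1) ∘ₗ (verma d m).act K = vermaCoord d m (s, k, l) :=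
    verma_ext fun s' k' l' t => by
      rw [LinearMap.comp_apply, K_vermaBas, vermaCoord_vermaBas, vermaCoord_vermaBas]
      simp
  exact LinearMap.congr_fun h x

theorem P_vermaBas_false (k l : ℕ) (t : ℂ × ℂ) :
    (verma d m).act P (vermaBas d m false k l t) =
      (l : ℂ) • vermaBas d m false (k + 1) (l - 1) t +
        (m * k) • vermaBas d m false (k - 1) l t :=
  vermaAct_bas _ _ _ _ _ _ _ _ _

theorem P_vermaBas_true (k l : ℕ) (t : ℂ × ℂ) :
    (verma d m).act P (vermaBas d m true k l t) =
      (l : ℂ) • vermaBas d m true (k + 1) (l - 1) t + vermaBas d m false k l (coefChi m t) +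
        (m * k) • vermaBas d m true (k - 1) l t :=
  vermaAct_bas _ _ _ _ _ _ _ _ _

theorem vermaCoord_P_zero (s : Bool) (l : ℕ) (x : verma d m) :
    vermaCoord d m (s, 0, l) ((verma d m).act P x) =
      m • vermaCoord d m (s, 1, l) x +
        (if s then 0 else coefChi m) (vermaCoord d m (true, 0, l) x) := by
  have h : vermaCoord d m (s, 0, l) ∘ₗ (verma d m).act P = m • vermaCoord d m (s, 1, l) +
      (if s then 0 else coefChi m) ∘ₗ vermaCoord d m (true, 0, l) :=
    verma_ext fun s' k' l' t => by
      cases s <;> cases s' <;> rcases k' with _ | _ | k' <;>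
        simp [P_vermaBas_false, P_vermaBas_true, vermaCoord_vermaBas]
      all_goals split_ifs <;> simp
  exact LinearMap.congr_fun h x

/-- With `P x = 0` and `m ≠ 0` this is a recursion giving the coordinates at `G^(k+2)` from those at
lower powers of `G`. -/
theorem vermaCoord_P_succ (s : Bool) (k l : ℕ) (x : verma d m) :
    vermaCoord d m (s, k + 1, l) ((verma d m).act P x) =
      ((l : ℂ) + 1) • vermaCoord d m (s, k, l + 1) x +
        (m * ((k : ℂ) + 2)) • vermaCoord d m (s, k + 2, l) x +
        (if s then 0 else coefChi m) (vermaCoord d m (true, k + 1, l) x) := by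
  have h : vermaCoord d m (s, k + 1, l) ∘ₗ (verma d m).act P =
      ((l : ℂ) + 1) • vermaCoord d m (s, k, l + 1) +
      (m * ((k : ℂ) + 2)) • vermaCoord d m (s, k + 2, l) +
      (if s then 0 else coefChi m) ∘ₗ vermaCoord d m (true, k + 1, l) :=
    verma_ext fun s' k' l' t => by
      cases s <;> cases s' <;> rcases k' with _ | k' <;> rcases l' with _ | l' <;>
        simp [P_vermaBas_false, P_vermaBas_true, vermaCoord_vermaBas] <;>
        split_ifs <;> simp_all <;> module
  exact LinearMap.congr_fun h x

/-- A vector killed by `P` is determined by its coordinates without `G`. -/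
theorem eq_zero_of_P_eq_zero (hm : m ≠ 0) {x : verma d m} (hP : (verma d m).act P x = 0)
    (h : ∀ s l, vermaCoord d m (s, 0, l) x = 0) : x = 0 := by
  have key : ∀ k, (∀ s l, vermaCoord d m (s, k, l) x = 0) ∧
      ∀ s l, vermaCoord d m (s, k + 1, l) x = 0 := by
    intro k
    induction k with
    | zero =>
      refine ⟨h, fun s l => ?_⟩
      have h1 := vermaCoord_P_zero s l x
      rw [hP, map_zero, h, map_zero, add_zero, eq_comm, smul_eq_zero] at h1
      exact h1.resolve_left hm
    | succ k ih =>
      refine ⟨ih.2, fun s l => ?_⟩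
      have h1 := vermaCoord_P_succ s k l x
      rw [hP, map_zero, ih.1, ih.2, map_zero, smul_zero, zero_add, add_zero, eq_comm,
        smul_eq_zero] at h1
      refine h1.resolve_left (mul_ne_zero hm ?_)
      exact_mod_cast (Nat.succ_ne_zero (k + 1))
  refine verma_ext_coord fun b => ?_
  rw [map_zero]
  exact (key b.2.1).1 b.1 b.2.2

end Massive

/-! ### The kernel of `P` and the action of `Q` on it -/

section Vacuum

variable (d : ℝ) (m : ℂ)

/-- The vectors `(G² - 2 m K)^l t v₀` (`s = false`) and `(G² - 2 m K)^l (G - 2 χ S) t v₀`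
(`s = true`), which are killed by `P`. -/
noncomputable def vacVec (s : Bool) (l : ℕ) : ℂ × ℂ →ₗ[ℂ] verma d m :=
  ((verma d m).reducedK m ^ l) ∘ₗ
    if s then vermaBas d m false 1 0 - vermaBas d m true 0 0 ∘ₗ ((2 : ℂ) • coefChi m)
    else vermaBas d m false 0 0

variable {d m}

theorem vacVec_succ (s : Bool) (l : ℕ) (t : ℂ × ℂ) :
    vacVec d m s (l + 1) t = (verma d m).reducedK m (vacVec d m s l t) := by
  simp [vacVec, pow_succ']

theorem vacVec_false_zero (t : ℂ × ℂ) : vacVec d m false 0 t = vermaBas d m false 0 0 t := by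
  simp [vacVec]

theorem vacVec_true_zero (t : ℂ × ℂ) :
    vacVec d m true 0 t =
      vermaBas d m false 1 0 t - (2 : ℂ) • vermaBas d m true 0 0 (coefChi m t) := by
  simp [vacVec]

theorem par_vacVec (s : Bool) (l : ℕ) (t : ℂ × ℂ) :
    (verma d m).par (vacVec d m s l t) = vacVec d m s l (coefPar t) := by
  induction l with
  | zero =>
    cases s
    · rw [vacVec_false_zero, vacVec_false_zero, par_vermaBas_false]
    · rw [vacVec_true_zero, vacVec_true_zero, map_sub, map_smul, par_vermaBas_false,
        par_vermaBas_true, coefPar_coefChi, map_neg, neg_neg]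
  | succ l ih => rw [vacVec_succ, vacVec_succ, SRep.reducedK_par, ih]

/-- `P G v₀ = m v₀` and `P χ S v₀ = χ² v₀ = (m/2) v₀`, whence the factor `2` in `G - 2χS`; powers of
`G² - 2mK` commute with `P`. -/
theorem P_vacVec (s : Bool) (l : ℕ) (t : ℂ × ℂ) :
    (verma d m).act P (vacVec d m s l t) = 0 := by
  induction l with
  | zero =>
    cases s
    · rw [vacVec_false_zero, P_vermaBas_zero]
    · rw [vacVec_true_zero, map_sub, map_smul, P_vermaBas_false, P_vermaBas_true,
        coefChi_coefChi, map_smul]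
      simp
      module
  | succ l ih => rw [vacVec_succ, SRep.P_reducedK _ (verma_M d m), ih, map_zero]

theorem D_vacVec (s : Bool) (l : ℕ) (t : ℂ × ℂ) :
    (verma d m).act D (vacVec d m s l t) =
      ((level (s, 0, l) : ℂ) - d) • vacVec d m s l t := by
  induction l with
  | zero =>
    cases s
    · rw [vacVec_false_zero, D_vermaBas_zero]
      simp [level]
    · have h1 := (verma d m).D_G (vermaBas d m false 0 0 t)
      have h2 := (verma d m).D_S (vermaBas d m false 0 0 (coefPar (coefChi m t)))
      rw [G_vermaBas, D_vermaBas_zero, map_smul, G_vermaBas] at h1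
      rw [S_vermaBas_false, D_vermaBas_zero, map_smul, S_vermaBas_false, coefPar_coefPar] at h2
      rw [vacVec_true_zero, map_sub, map_smul, h1, h2]
      simp only [level, Bool.toNat_true]
      push_cast
      module
  | succ l ih =>
    rw [vacVec_succ, SRep.D_reducedK, ih, map_smul]
    simp only [level]
    push_cast
    module

theorem X_vacVec (s : Bool) (l : ℕ) (t : ℂ × ℂ) :
    (verma d m).act X (vacVec d m s l t) =
      (if s then (-1 : ℂ) else 1) • vacVec d m s l (coefChi m (coefPar t)) := by
  induction l with
  | zero =>
    cases s
    · rw [vacVec_false_zero, vacVec_false_zero, X_vermaBas_false]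
      simp
    · rw [vacVec_true_zero, vacVec_true_zero, map_sub, map_smul, X_vermaBas_false,
        X_vermaBas_true, coefPar_coefChi, map_neg, map_neg, map_neg]
      simp
      module
  | succ l ih => rw [vacVec_succ, vacVec_succ, SRep.X_reducedK, ih, map_smul]

/-- `2GX - 2mS` is the commutator of `Q` with `G² - 2mK`. With `X` acting as `χ` up to sign and `2χ²
= m`, it exchanges the two families of vectors killed by `P`. -/
theorem GX_sub_S_vacVec_false (l : ℕ) (t : ℂ × ℂ) :
    (2 : ℂ) • (verma d m).act G ((verma d m).act X (vacVec d m false l t)) -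
        (2 * m) • (verma d m).act S (vacVec d m false l t) =
      (2 : ℂ) • vacVec d m true l (coefChi m (coefPar t)) := by
  induction l with
  | zero =>
    rw [X_vacVec, vacVec_false_zero, vacVec_false_zero, vacVec_true_zero, map_smul, G_vermaBas,
      S_vermaBas_false, coefChi_coefChi, map_smul]
    simp
    module
  | succ l ih =>
    rw [vacVec_succ, vacVec_succ, ← map_smul ((verma d m).reducedK m), ← ih]
    simp [SRep.X_reducedK, SRep.S_reducedK, SRep.G_reducedK]

theorem GX_sub_S_vacVec_true (l : ℕ) (t : ℂ × ℂ) :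
    (2 : ℂ) • (verma d m).act G ((verma d m).act X (vacVec d m true l t)) -
        (2 * m) • (verma d m).act S (vacVec d m true l t) =
      (-2 : ℂ) • vacVec d m false (l + 1) (coefChi m (coefPar t)) := by
  induction l with
  | zero =>
    rw [X_vacVec, vacVec_succ, vacVec_false_zero, vacVec_true_zero, vacVec_true_zero,
      SRep.reducedK_apply]
    simp only [map_sub, map_smul, G_vermaBas, K_vermaBas, S_vermaBas_false, S_vermaBas_true,
      coefChi_coefChi, coefPar_coefChi, map_neg, if_true]
    module
  | succ l ih =>
    rw [vacVec_succ, vacVec_succ, ← map_smul ((verma d m).reducedK m), ← ih]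
    simp [SRep.X_reducedK, SRep.S_reducedK, SRep.G_reducedK]

theorem Q_vacVec_false_succ (l : ℕ) (t : ℂ × ℂ) :
    (verma d m).act Q (vacVec d m false (l + 1) t) =
      (2 * ((l : ℂ) + 1)) • vacVec d m true l (coefChi m (coefPar t)) := by
  induction l with
  | zero =>
    rw [vacVec_succ, SRep.Q_reducedK, GX_sub_S_vacVec_false, vacVec_false_zero, Q_vermaBas_zero,
      map_zero]
    simp
  | succ l ih =>
    rw [vacVec_succ, SRep.Q_reducedK, GX_sub_S_vacVec_false, ih, map_smul, ← vacVec_succ]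
    push_cast
    module

/-- The `1` comes from `[Q, G] = X`, the `2d` from `{Q, S} = -D` on `v₀`, and each factor `G² - 2mK`
contributes `-2`. The zero at `d = l - 1/2` is the source of the exceptional weights. -/
theorem Q_vacVec_true (l : ℕ) (t : ℂ × ℂ) :
    (verma d m).act Q (vacVec d m true l t) =
      (1 + 2 * (d : ℂ) - 2 * l) • vacVec d m false l (coefChi m (coefPar t)) := by
  induction l with
  | zero =>
    have h1 := (verma d m).Q_G (vermaBas d m false 0 0 t)
    have h2 := (verma d m).Q_S (vermaBas d m false 0 0 (coefPar (coefChi m t)))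
    rw [G_vermaBas, Q_vermaBas_zero, map_zero, zero_add, X_vermaBas_false] at h1
    rw [S_vermaBas_false, Q_vermaBas_zero, map_zero, D_vermaBas_zero, coefPar_coefPar,
      coefPar_coefChi, map_neg] at h2
    rw [vacVec_true_zero, vacVec_false_zero, map_sub, map_smul, h1, h2]
    push_cast
    module
  | succ l ih =>
    rw [vacVec_succ, SRep.Q_reducedK, GX_sub_S_vacVec_true, ih, map_smul, ← vacVec_succ]
    push_cast
    module

theorem coefChi_coefPar_surjective (hm : m ≠ 0) (t : ℂ × ℂ) :
    ∃ t', coefChi m (coefPar t') = t := by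
  refine ⟨coefPar ((2 / m) • coefChi m t), ?_⟩
  rw [coefPar_coefPar, map_smul, coefChi_coefChi, smul_smul, div_mul_div_comm, mul_comm 2 m,
    div_self (mul_ne_zero hm two_ne_zero), one_smul]

/-- The coefficients `ℂ ⊕ ℂ χ` have no proper graded ideals. -/
theorem coef_eq_top (hm : m ≠ 0) {E : Submodule ℂ (ℂ × ℂ)} (hσ : ∀ t ∈ E, coefPar t ∈ E)
    (hχ : ∀ t ∈ E, coefChi m (coefPar t) ∈ E) {t : ℂ × ℂ} (ht : t ∈ E) (h0 : t ≠ 0) : E = ⊤ := by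
  have h10 : ((1 : ℂ), (0 : ℂ)) ∈ E := by
    have h1 : t.1 ≠ 0 → ((1 : ℂ), (0 : ℂ)) ∈ E := by
      intro h
      have h2 := E.smul_mem (2 * t.1)⁻¹ (E.add_mem ht (hσ t ht))
      convert h2 using 1
      ext
      · simp [coefPar_apply]
        field_simp
        norm_num
      · simp [coefPar_apply]
    by_cases h : t.1 = 0
    · have h2 := E.smul_mem (-(m / 2 * t.2))⁻¹ (hχ t ht)
      have h3 : t.2 ≠ 0 := fun h3 => h0 (Prod.ext h h3)
      convert h2 using 1
      ext
      · simp [coefPar_apply, coefChi_apply]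
        field_simp
      · simp [coefPar_apply, coefChi_apply, h]
    · exact h1 h
  have h01 : ((0 : ℂ), (1 : ℂ)) ∈ E := by
    have := hχ _ h10
    simpa [coefPar_apply, coefChi_apply] using this
  rw [eq_top_iff]
  intro x _
  have h := E.add_mem (E.smul_mem x.1 h10) (E.smul_mem x.2 h01)
  simpa using h

/-- The admissible coefficients form a graded ideal, since `X` acts as multiplication by `χ` up to
sign; a nonzero one is everything. -/
theorem vacVec_mem_of_mem (hm : m ≠ 0) {N : Submodule ℂ (verma d m)}
    (hg : (verma d m).Graded N) (hs : (verma d m).Stable Set.univ N) {s : Bool} {l : ℕ}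
    {t : ℂ × ℂ} (ht : t ≠ 0) (h : vacVec d m s l t ∈ N) (t' : ℂ × ℂ) :
    vacVec d m s l t' ∈ N := by
  have htop : N.comap (vacVec d m s l) = ⊤ := by
    refine coef_eq_top hm (fun t ht => ?_) (fun t ht => ?_) (show t ∈ N.comap _ from h) ht
    · rw [Submodule.mem_comap, ← par_vacVec]
      exact hg _ ht
    · have h1 := hs X trivial _ ht
      rw [X_vacVec] at h1
      refine (N.smul_mem_iff ?_).mp h1
      cases s <;> simp
  have : t' ∈ N.comap (vacVec d m s l) := htop ▸ Submodule.mem_top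
  exact this

theorem vacVec_true_mem (hm : m ≠ 0) {N : Submodule ℂ (verma d m)}
    (hs : (verma d m).Stable Set.univ N) {l : ℕ}
    (h : ∀ t, vacVec d m false (l + 1) t ∈ N) (t : ℂ × ℂ) : vacVec d m true l t ∈ N := by
  obtain ⟨t, rfl⟩ := coefChi_coefPar_surjective hm t
  have h1 := hs Q trivial _ (h t)
  rw [Q_vacVec_false_succ] at h1
  exact (N.smul_mem_iff (mul_ne_zero two_ne_zero (Nat.cast_add_one_ne_zero l))).mp h1

theorem vacVec_false_mem (hm : m ≠ 0) {N : Submodule ℂ (verma d m)}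
    (hs : (verma d m).Stable Set.univ N) {l : ℕ} (hl : d ≠ l - 1 / 2)
    (h : ∀ t, vacVec d m true l t ∈ N) (t : ℂ × ℂ) : vacVec d m false l t ∈ N := by
  obtain ⟨t, rfl⟩ := coefChi_coefPar_surjective hm t
  have h1 := hs Q trivial _ (h t)
  rw [Q_vacVec_true] at h1
  refine (N.smul_mem_iff fun e => hl ?_).mp h1
  have h2 : 1 + 2 * d - 2 * l = 0 := by exact_mod_cast e
  linarith

theorem vacVec_zero_mem (hm : m ≠ 0) {N : Submodule ℂ (verma d m)}
    (hs : (verma d m).Stable Set.univ N) {l : ℕ} (hl : ∀ j < l, d ≠ j - 1 / 2)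
    (h : ∀ t, vacVec d m false l t ∈ N) (t : ℂ × ℂ) : vacVec d m false 0 t ∈ N := by
  induction l with
  | zero => exact h t
  | succ l ih =>
    exact ih (fun j hj => hl j (hj.trans (Nat.lt_succ_self l)))
      (vacVec_false_mem hm hs (hl l (Nat.lt_succ_self l)) (vacVec_true_mem hm hs h))

theorem eq_top_of_vacVec_mem (hm : m ≠ 0) {N : Submodule ℂ (verma d m)}
    (hg : (verma d m).Graded N) (hs : (verma d m).Stable Set.univ N) {s : Bool} {l : ℕ}
    {t : ℂ × ℂ} (ht : t ≠ 0) (h : vacVec d m s l t ∈ N)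
    (hl : ∀ j < l + s.toNat, d ≠ j - 1 / 2) : N = ⊤ := by
  have h1 := vacVec_mem_of_mem hm hg hs ht h
  refine verma_eq_top_of_mem hs ?_
  change vermaBas d m false 0 0 (1, 0) ∈ N
  rw [← vacVec_false_zero]
  cases s
  · exact vacVec_zero_mem hm hs hl h1 _
  · exact vacVec_zero_mem hm hs (fun j hj => hl j (hj.trans (Nat.lt_succ_self l)))
      (vacVec_false_mem hm hs (hl l (Nat.lt_succ_self l)) h1) _

/-- Only the terms free of `G` count: `-2mK` from each factor, and `-2χS` from `G - 2χS`. For `m ≠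
0` the result can be prescribed arbitrarily. -/
theorem vermaCoord_vacVec (s : Bool) (l : ℕ) (t : ℂ × ℂ) :
    vermaCoord d m (s, 0, l) (vacVec d m s l t) =
      (-(2 * m)) ^ l • if s then -((2 : ℂ) • coefChi m t) else t := by
  induction l with
  | zero =>
    cases s
    · rw [vacVec_false_zero, vermaCoord_vermaBas]
      simp
    · rw [vacVec_true_zero, map_sub, map_smul, vermaCoord_vermaBas, vermaCoord_vermaBas]
      simp
  | succ l ih =>
    rw [vacVec_succ, SRep.reducedK_apply, map_sub, map_smul, vermaCoord_G_zero,
      vermaCoord_K_succ, ih, pow_succ]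
    module

/-- Every weight vector killed by `P` is one of the vectors `vacVec`. -/
theorem exists_eq_vacVec (hm : m ≠ 0) {x : verma d m} {n : ℕ}
    (hP : (verma d m).act P x = 0) (hD : (verma d m).act D x = ((n : ℂ) - d) • x) :
    ∃ s l t, x = vacVec d m s l t := by
  obtain ⟨s, l, rfl⟩ : ∃ s l, n = level (s, 0, l) :=
    ⟨n.bodd, n.div2, by
      have := Nat.bodd_add_div2 n
      cases h : n.bodd <;> rw [h] at this <;> simp [level] at this ⊢ <;> omega⟩
  obtain ⟨t, ht⟩ : ∃ t, vermaCoord d m (s, 0, l) (vacVec d m s l t) =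
      vermaCoord d m (s, 0, l) x := by
    have hc : (-(2 * m)) ^ l ≠ 0 := pow_ne_zero _ (neg_ne_zero.mpr (mul_ne_zero two_ne_zero hm))
    set y := vermaCoord d m (s, 0, l) x
    cases s
    · refine ⟨((-(2 * m)) ^ l)⁻¹ • y, ?_⟩
      rw [vermaCoord_vacVec]
      simp [smul_smul, hc]
    -- The inverse of `-2χ` is `-χ/m`, because `2χ² = m`.
    · refine ⟨((-(2 * m)) ^ l)⁻¹ • (-(1 / m)) • coefChi m y, ?_⟩
      rw [vermaCoord_vacVec]
      simp only [map_smul, coefChi_coefChi, if_true, smul_smul]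
      rw [← neg_smul, smul_smul]
      convert one_smul ℂ y using 2
      field_simp
  refine ⟨s, l, t, ?_⟩
  rw [← sub_eq_zero]
  -- The difference is killed by `P`, so only coordinates without `G` matter; at a given level there
  -- is just one, and it was matched by the choice of `t`.
  refine eq_zero_of_P_eq_zero hm (by rw [map_sub, hP, P_vacVec, sub_zero]) fun s' l' => ?_
  by_cases h : level (s', 0, l') = level (s, 0, l)
  · have : s' = s ∧ l' = l := by
      cases s <;> cases s' <;> simp [level] at h ⊢ <;> omega
    rw [this.1, this.2, map_sub, ht, sub_self]
  · exact vermaCoord_eq_zero_of_level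
      (by rw [map_sub, hD, D_vacVec, smul_sub]) h

/-- A proper graded submodule is contained in every `G, K, S`-stable subspace that contains the
vectors `vacVec` from which one cannot descend to `v₀`. -/
theorem proper_le (hm : m ≠ 0) {N I : Submodule ℂ (verma d m)} (hg : (verma d m).Graded N)
    (hs : (verma d m).Stable Set.univ N) (hN : N ≠ ⊤) (hI : (verma d m).Stable plus I)
    (h : ∀ (s : Bool) (l j : ℕ) (t : ℂ × ℂ), j < l + s.toNat → d = j - 1 / 2 →
      vacVec d m s l t ∈ I) : N ≤ I := by
  refine (verma d m).le_of_inf_ker_P_le hm (verma_M d m) (verma_P_nilpotent d m) hs hI ?_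
  have hle : N ⊓ LinearMap.ker ((verma d m).act P) ≤ I := by
    refine verma_le_of_weight_vectors ?_ ?_
    · rintro x ⟨hx, hP⟩
      refine ⟨hs D trivial x hx, ?_⟩
      rw [SetLike.mem_coe, LinearMap.mem_ker] at hP ⊢
      rw [SRep.P_D, hP, map_zero, add_zero]
    · rintro n x ⟨hx, hP⟩ hD
      obtain ⟨s, l, t, rfl⟩ := exists_eq_vacVec hm hP hD
      by_cases ht : t = 0
      · rw [ht, map_zero]
        exact I.zero_mem
      · by_contra hxI
        exact hN (eq_top_of_vacVec_mem hm hg hs ht hx fun j hj hd => hxI (h s l j t hj hd))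
  exact fun x hx hP => hle ⟨hx, hP⟩

end Vacuum

/-! ### Nonzero mass: the irreducible modules -/

section MassiveClassification

theorem verma_irreducible {m : ℂ} {d : ℝ} (hm : m ≠ 0) (hd : ∀ p : ℕ, d ≠ p - 1 / 2) :
    (verma d m).Irreducible := by
  refine ⟨⟨⟨_, _, (vermaVec_isLowestWeightVector d m).1⟩⟩, fun N hg hs => ?_⟩
  rw [or_iff_not_imp_right]
  intro hN
  rw [eq_bot_iff]
  refine proper_le hm hg hs hN ?_ fun s l j t _ h => (hd j h).elim
  intro a _ x hx
  rw [Submodule.mem_bot] at hx ⊢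
  rw [hx, map_zero]

theorem chiMul_vermaBas (d : ℝ) (m : ℂ) (s : Bool) (k l : ℕ) (t : ℂ × ℂ) :
    chiMul d m (vermaBas d m s k l t) = vermaBas d m s k l (coefChi m t) :=
  Finsupp.mapRange_single (hf := map_zero _)

theorem chiMul_reducedK (d : ℝ) (m : ℂ) (x : verma d m) :
    chiMul d m ((verma d m).reducedK m x) = (verma d m).reducedK m (chiMul d m x) := by
  have h : chiMul d m ∘ₗ (verma d m).reducedK m = (verma d m).reducedK m ∘ₗ chiMul d m :=
    verma_ext fun s k l t => by
      simp [SRep.reducedK_apply, G_vermaBas, K_vermaBas, chiMul_vermaBas]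
  exact LinearMap.congr_fun h x

theorem chiMul_vacVec (d : ℝ) (m : ℂ) (s : Bool) (l : ℕ) (t : ℂ × ℂ) :
    chiMul d m (vacVec d m s l t) = vacVec d m s l (coefChi m t) := by
  induction l with
  | zero =>
    cases s
    · rw [vacVec_false_zero, vacVec_false_zero, chiMul_vermaBas]
    · rw [vacVec_true_zero, vacVec_true_zero, map_sub, map_smul, chiMul_vermaBas,
        chiMul_vermaBas]
  | succ l ih => rw [vacVec_succ, vacVec_succ, chiMul_reducedK, ih]

theorem singVec_eq (p : ℕ) (m : ℂ) : singVec p m = vacVec (p - 1 / 2) m true p (1, 0) := by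
  have h : (verma (p - 1 / 2) m).act G (vermaVec (p - 1 / 2) m) -
      (2 : ℂ) • chiMul (p - 1 / 2) m ((verma (p - 1 / 2) m).act S (vermaVec (p - 1 / 2) m)) =
      vacVec (p - 1 / 2) m true 0 (1, 0) := by
    change (verma (p - 1 / 2) m).act G (vermaBas (p - 1 / 2) m false 0 0 (1, 0)) -
      (2 : ℂ) • chiMul (p - 1 / 2) m
        ((verma (p - 1 / 2) m).act S (vermaBas (p - 1 / 2) m false 0 0 (1, 0))) = _
    rw [vacVec_true_zero, G_vermaBas, S_vermaBas_false, chiMul_vermaBas]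
    simp [coefPar_apply]
  have hpow : ∀ l, ((verma (p - 1 / 2) m).reducedK m ^ l)
      (vacVec (p - 1 / 2) m true 0 (1, 0)) = vacVec (p - 1 / 2) m true l (1, 0) := by
    intro l
    induction l with
    | zero => rfl
    | succ l ih => rw [pow_succ', Module.End.mul_apply, ih, vacVec_succ]
  rw [← hpow, ← h]
  rfl

variable (p : ℕ) (m : ℂ)

theorem vacVec_mem_orbit (t : ℂ × ℂ) : vacVec (p - 1 / 2) m true p t ∈
    (verma (p - 1 / 2) m).orbit plus {singVec p m, chiMul (p - 1 / 2) m (singVec p m)} := by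
  have h1 := (verma (p - 1 / 2) m).subset_orbit plus
    {singVec p m, chiMul (p - 1 / 2) m (singVec p m)} (Set.mem_insert _ _)
  have h2 := (verma (p - 1 / 2) m).subset_orbit plus
    {singVec p m, chiMul (p - 1 / 2) m (singVec p m)} (Set.mem_insert_of_mem _ rfl)
  have e : vacVec (p - 1 / 2) m true p t =
      t.1 • singVec p m + t.2 • chiMul (p - 1 / 2) m (singVec p m) := by
    rw [singVec_eq, chiMul_vacVec, ← map_smul, ← map_smul, ← map_add]
    congr 1
    ext <;> simp [coefChi_apply]
  rw [e]
  exact Submodule.add_mem _ (Submodule.smul_mem _ _ h1) (Submodule.smul_mem _ _ h2)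

/-- For `d = p - 1/2` the coefficient `1 + 2d - 2p` vanishes, so `Q`, and with it `H = -Q²`, kills
the singular vector. Since `X` multiplies it by `-χ`, its multiple by `χ` belongs to the same
submodule. -/
theorem singSub_space_eq_orbit :
    (singSub p m).space = (verma (p - 1 / 2) m).orbit plus
      {singVec p m, chiMul (p - 1 / 2) m (singVec p m)} := by
  have hW : ∀ w ∈ ({singVec p m, chiMul (p - 1 / 2) m (singVec p m)} :
      Set (verma (p - 1 / 2) m)), ∃ t, w = vacVec (p - 1 / 2) m true p t := by
    rintro w (rfl | rfl)
    · exact ⟨_, singVec_eq p m⟩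
    · exact ⟨_, by rw [singVec_eq, chiMul_vacVec]⟩
  have hmem := vacVec_mem_orbit p m
  refine (verma (p - 1 / 2) m).gen_eq_orbit_plus (Set.singleton_subset_iff.mpr
    (Set.mem_insert _ _)) ?_ ?_ ?_
  · have h1 := (verma (p - 1 / 2) m).subset_gen {singVec p m} rfl
    rintro _ (rfl | rfl)
    · exact h1
    · have h2 := ((verma (p - 1 / 2) m).gen {singVec p m}).stable X trivial _ h1
      have e : chiMul (p - 1 / 2) m (singVec p m) =
          -(verma (p - 1 / 2) m).act X (singVec p m) := by
        rw [singVec_eq, chiMul_vacVec, X_vacVec]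
        simp [coefPar_apply]
      rw [e]
      exact Submodule.neg_mem _ h2
  · intro w hw
    obtain ⟨t, rfl⟩ := hW w hw
    rw [par_vacVec]
    exact hmem _
  · intro a ha w hw
    obtain ⟨t, rfl⟩ := hW w hw
    have hQ : (verma (p - 1 / 2) m).act Q (vacVec (p - 1 / 2) m true p t) = 0 := by
      rw [Q_vacVec_true]
      push_cast
      convert zero_smul ℂ _
      ring
    cases a
    case G => simp [plus] at ha
    case K => simp [plus] at ha
    case S => simp [plus] at ha
    case H =>
      rw [← neg_neg ((verma (p - 1 / 2) m).act H _), ← SRep.Q_Q, hQ, map_zero, neg_zero]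
      exact Submodule.zero_mem _
    case P =>
      rw [P_vacVec]
      exact Submodule.zero_mem _
    case D =>
      rw [D_vacVec]
      exact Submodule.smul_mem _ _ (hmem t)
    case M =>
      rw [verma_M]
      exact Submodule.smul_mem _ _ (hmem t)
    case Q =>
      rw [hQ]
      exact Submodule.zero_mem _
    case X =>
      rw [X_vacVec]
      exact Submodule.smul_mem _ _ (hmem _)

theorem singSub_stable_plus : (verma (p - 1 / 2) m).Stable plus (singSub p m).space :=
  (singSub p m).stable.mono (Set.subset_univ _)

variable {m}

/-- Powers of `G² - 2mK` climb along the odd levels, and `2GX - 2mS` passes from each to the next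
even level, up to the invertible `χ`. -/
theorem vacVec_mem_singSub (hm : m ≠ 0) {s : Bool} {l : ℕ} (h : p < l + s.toNat) (t : ℂ × ℂ) :
    vacVec (p - 1 / 2) m s l t ∈ (singSub p m).space := by
  have htrue : ∀ j t, vacVec (p - 1 / 2) m true (p + j) t ∈ (singSub p m).space := by
    intro j
    induction j with
    | zero =>
      intro t
      rw [singSub_space_eq_orbit]
      exact vacVec_mem_orbit p m t
    | succ j ih =>
      intro t
      rw [← add_assoc, vacVec_succ]
      exact SRep.reducedK_mem _ (singSub_stable_plus p m) (ih t)
  cases s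
  · obtain ⟨j, rfl⟩ : ∃ j, l = p + j + 1 := ⟨l - p - 1, by simp at h; omega⟩
    obtain ⟨t, rfl⟩ := coefChi_coefPar_surjective hm t
    have hs := (singSub p m).stable
    have h1 := Submodule.sub_mem _
      (Submodule.smul_mem _ (2 : ℂ) (hs G trivial _ (hs X trivial _ (htrue j t))))
      (Submodule.smul_mem _ (2 * m) (hs S trivial _ (htrue j t)))
    rw [GX_sub_S_vacVec_true] at h1
    exact (Submodule.smul_mem_iff _ (by norm_num)).mp h1
  · obtain ⟨j, rfl⟩ : ∃ j, l = p + j := ⟨l - p, by simp at h; omega⟩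
    exact htrue j t

variable (m)

/-- The generators have level `2p + 1` and `G, K, S` only raise levels, so level `0` is never
reached. -/
theorem vermaVec_notMem_singSub : vermaVec (p - 1 / 2) m ∉ (singSub p m).space := by
  rw [singSub_space_eq_orbit]
  intro h
  have hle : (verma (p - 1 / 2) m).orbit plus
      {singVec p m, chiMul (p - 1 / 2) m (singVec p m)} ≤
      (Finsupp.supported (ℂ × ℂ) ℂ {b | 0 < level b} : Submodule ℂ (verma (p - 1 / 2) m)) := by
    refine (verma (p - 1 / 2) m).orbit_le ?_ ?_
    · have hv : ∀ t, vacVec (p - 1 / 2) m true p t ∈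
          (Finsupp.supported (ℂ × ℂ) ℂ {b | 0 < level b} :
            Submodule ℂ (verma (p - 1 / 2) m)) := by
        intro t
        refine (Finsupp.mem_supported' ℂ _).mpr fun b hb => ?_
        refine vermaCoord_eq_zero_of_level (D_vacVec true p t) fun e => hb ?_
        change 0 < level b
        rw [e]
        simp [level]
      rintro _ (rfl | rfl)
      · rw [singVec_eq]
        exact hv _
      · rw [singVec_eq, chiMul_vacVec]
        exact hv _
    · refine supported_stable_plus ?_ ?_ ?_ ?_ <;> intros <;> simp_all [level]
  have h1 : vermaCoord (p - 1 / 2) m (false, 0, 0) (vermaVec (p - 1 / 2) m) = 0 :=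
    (Finsupp.mem_supported' ℂ _).mp (hle h) _ (by simp [level])
  have h2 := (vermaCoord_vermaBas (d := p - 1 / 2) (m := m) (false, 0, 0) false 0 0
    (1, 0)).symm.trans h1
  simp at h2

theorem verma_quot_isLowestWeight :
    ((verma (p - 1 / 2) m).quot (singSub p m)).IsLowestWeight (p - 1 / 2) m :=
  ⟨_, SRep.isLowestWeightVector_proj _ _ (vermaVec_isLowestWeightVector _ m)
    (vermaVec_notMem_singSub p m), SRep.orbit_proj_eq_top _ _ _ (vermaVec_orbit _ m)⟩

variable {m}

theorem verma_quot_irreducible (hm : m ≠ 0) :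
    ((verma (p - 1 / 2) m).quot (singSub p m)).Irreducible := by
  refine SRep.irreducibleUnder_quot _ _ _ ?_ fun N hg hs _ => ?_
  · intro h
    exact vermaVec_notMem_singSub p m (h ▸ Submodule.mem_top)
  · rw [or_iff_not_imp_right]
    intro hN
    refine proper_le hm hg hs hN (singSub_stable_plus p m) fun s l j t hj hd => ?_
    have hjp : p = j := by
      have : (p : ℝ) = j := by linarith
      exact_mod_cast this
    exact vacVec_mem_singSub p hm (hjp ▸ hj) t

theorem SRep.IsLowestWeight.not_finiteDimensional {V : SRep.{u}} {d : ℝ}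
    (h : V.IsLowestWeight d m) (hm : m ≠ 0) : ¬ FiniteDimensional ℂ V := by
  obtain ⟨v, hv, hv'⟩ := h
  have : Nontrivial V := ⟨⟨v, 0, hv.1⟩⟩
  exact V.not_finiteDimensional_of_mass hm (V.M_eq_smul hv.2.2.2.2.2 hv')

end MassiveClassification

end SSch

theorem proposition3 :
    -- mass `m ≠ 0`, `d ≠ p - 1/2`: the Verma module `V^d`
    (∀ (m : ℂ) (d : ℝ), m ≠ 0 → (∀ p : ℕ, d ≠ p - 1 / 2) →
      IsTheIrreducible.{u} (verma d m) d m ∧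
      ¬ FiniteDimensional ℂ (verma d m)) ∧
    -- mass `m ≠ 0`, `d = p - 1/2`: the quotient `V^d / I^d`, with `I^d = U(s⁺) v_s`
    (∀ (m : ℂ) (p : ℕ), m ≠ 0 →
      (singSub p m).space = (verma (p - 1 / 2) m).orbit plus
        {singVec p m, chiMul (p - 1 / 2) m (singVec p m)} ∧
      IsTheIrreducible.{u} ((verma (p - 1 / 2) m).quot (singSub p m)) (p - 1 / 2) m ∧
      ¬ FiniteDimensional ℂ ((verma (p - 1 / 2) m).quot (singSub p m))) ∧
    -- the submodule `I^1 = U(s⁺) G v₀` for mass `0`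
    (∀ d : ℝ, (singSub₀ d).space =
      (verma₀ d).orbit plus {(verma₀ d).act Gen.G (verma₀Vec d)}) ∧
    -- mass `0`, `d ∉ {0, 1, 2, …}`: the quotient `V^d / I^1`
    (∀ d : ℝ, (∀ p : ℕ, d ≠ p) →
      IsTheIrreducible.{u} (factor₀ d) d 0 ∧
      ¬ FiniteDimensional ℂ (factor₀ d) ∧
      (factor₀ d).IrreducibleUnder osp) ∧
    -- mass `0`, `d = p ∈ {0, 1, 2, …}`: the quotient of `V^p / I^1` by `U(s⁺) K^p S w₀`
    (∀ p : ℕ,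
      (singSub₁ p).space = (factor₀ p).orbit plus {singVec₁ p} ∧
      IsTheIrreducible.{u} ((factor₀ p).quot (singSub₁ p)) p 0 ∧
      FiniteDimensional ℂ ((factor₀ p).quot (singSub₁ p)) ∧
      Module.finrank ℂ ((factor₀ p).quot (singSub₁ p)) = 2 * p + 1 ∧
      ((factor₀ p).quot (singSub₁ p)).IrreducibleUnder osp) ∧
    -- different parameters give inequivalent modules
    (∀ (V : SRep.{u}) (W : SRep.{v}) (d d' : ℝ) (m m' : ℂ),
      V.Irreducible → W.Irreducible → V.IsLowestWeight d m → W.IsLowestWeight d' m' →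
      Isomorphic V W → d = d' ∧ m = m') := by
  refine ⟨fun m d hm hd => ?_, fun m p hm => ?_, singSub₀_space_eq_orbit, fun d hd => ?_,
    fun p => ?_, fun V W d d' m m' _ _ hV hW h => IsLowestWeight.eq_of_isomorphic hV hW h⟩
  · have hl : (verma d m).IsLowestWeight d m :=
      ⟨_, vermaVec_isLowestWeightVector d m, vermaVec_orbit d m⟩
    exact ⟨isTheIrreducible_of_irreducible (verma_irreducible hm hd) hl,
      hl.not_finiteDimensional hm⟩
  · have hl := verma_quot_isLowestWeight p m
    exact ⟨singSub_space_eq_orbit p m,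
      isTheIrreducible_of_irreducible (verma_quot_irreducible p hm) hl,
      hl.not_finiteDimensional hm⟩
  · have hirr := factor₀_irreducibleUnder_osp hd
    exact ⟨isTheIrreducible_of_irreducible hirr.irreducible (factor₀_isLowestWeight d),
      factor₀_not_finiteDimensional d, hirr⟩
  · have hirr := factor₀_quot_irreducibleUnder_osp p
    refine ⟨singSub₁_space_eq_orbit p,
      isTheIrreducible_of_irreducible hirr.irreducible (factor₀_quot_isLowestWeight p),
      Module.Finite.equiv (factor₀QuotEquiv p).symm, ?_, hirr⟩
    rw [(factor₀QuotEquiv p).finrank_eq, Module.finrank_fin_fun]
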